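/- Let $(X,T,Y(1),Y(0))$ be the covariates, the binary treatment and the real potential outcomes of a generic unit, with strong ignorability $(Y(1),Y(0))\perp T\mid X$, and let $Y^{\mathrm{obs}}=Y(T)$ (SUTVA). Let $e(x)=\mathbb P(T=1\mid X=x)$, let $q_\beta(x)$ be the $\beta$-th quantile of $Y(1)$ given $X=x$, and suppose that $e(X)>0$ almost surely. Fix $\alpha,\alpha_{\mathrm{lo}},\alpha_{\mathrm{hi}}\in(0,1)$. *Data and algorithm.* A training fold $\mathcal Z_{\mathrm{tr}}$ consists of $N$ records (of any joint law). A calibration fold consists of $n$ treated units $(X_i,Y_i)$, i.i.d. from the law of $(X,Y^{\mathrm{obs}})$ given $T=1$. The two folds and a test unit $(X,Y(1))\sim P_X\times P_{Y(1)\mid X}$ are independent. From $\mathcal Z_{\mathrm{tr}}$ one computes (jointly measurable) functions $\hat q_{\alpha_{\mathrm{lo}},N},\hat q_{\alpha_{\mathrm{hi}},N}:\mathcal X\to\mathbb R$ and $\hat e_N:\mathcal X\to[0,1]$. Put $\hat w=1/\hat e_N\in[1,\infty]$, $V_i=\max\{\hat q_{\alpha_{\mathrm{lo}},N}(X_i)-Y_i,\;Y_i-\hat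 q_{\alpha_{\mathrm{hi}},N}(X_i)\}$, $$\hat p_i(x)=\frac{\hat w(X_i)}{\sum_{j}\hat w(X_j)+\hat w(x)},\qquad \hat p_\infty(x)=\frac{\hat w(x)}{\sum_{j}\hat w(X_j)+\hat w(x)}$$ (with $\hat p_i(x)=0$, $\hat p_\infty(x)=1$ if $\hat w(x)=\infty$), let $\eta(x)$ be the $(1-\alpha)$-th quantile of $\sum_i\hat p_i(x)\delta_{V_i}+\hat p_\infty(x)\delta_\infty$, and let $\hat C_{N,n}(x)=[\hat q_{\alpha_{\mathrm{lo}},N}(x)-\eta(x),\;\hat q_{\alpha_{\mathrm{hi}},N}(x)+\eta(x)]$ be the interval of weighted split-CQR. *Conditions.* Write $\mathbb E_1$ for the expectation over $\mathcal Z_{\mathrm{tr}}$ and an independent $X\sim P_{X\mid T=1}$. (Since $dP_{X\mid T=1}/dP_X=e/\mathbb P(T=1)\le 1/\mathbb P(T=1)$, each condition below holds whenever it holds with $X\sim P_X$ instead. Moreover $\mathbb E[1/e(X)\mid T=1]=1/\mathbb P(T=1)<\infty$.) Assume $\mathbb E_1[1/\hat e_N(X)\mid\mathcal Z_{\mathrm{tr}}]<\infty$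 almost surely for every $N$. Consider * **A1.** $\displaystyle\lim_{N\to\infty}\mathbb E_1\left|\frac1{\hat e_N(X)}-\frac1{e(X)}\right|=0$. * **A2.** (1) $\alpha_{\mathrm{hi}}-\alpha_{\mathrm{lo}}=1-\alpha$; (2) there are $r,b_1,b_2>0$ such that, for $P_X$-almost every $x$, the conditional law of $Y(1)$ given $X=x$ has on $[q_{\alpha_{\mathrm{lo}}}(x)-r,q_{\alpha_{\mathrm{lo}}}(x)+r]\cup[q_{\alpha_{\mathrm{hi}}}(x)-r,q_{\alpha_{\mathrm{hi}}}(x)+r]$ a density with values in $[b_1,b_2]$; (3) with $H_N(x)=\max\{|\hat q_{\alpha_{\mathrm{lo}},N}(x)-q_{\alpha_{\mathrm{lo}}}(x)|,|\hat q_{\alpha_{\mathrm{hi}},N}(x)-q_{\alpha_{\mathrm{hi}}}(x)|\}$, there is $\delta>0$ with $$\limsup_{N\to\infty}\mathbb E_1\left[\frac1{\hat e_N(X)^{1+\delta}}\right]<\infty,\qquad \lim_{N\to\infty}\mathbb E_1\left[\frac{H_N(X)}{\hat e_N(X)}\right]=\lim_{N\to\infty}\mathbb E_1\left[\frac{H_N(X)}{e(X)}\right]=0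 .$$ *Conclusion.* If A1 or A2 holds, then $$\liminf_{N,n\to\infty}\ \mathbb P\big(Y(1)\in\hat C_{N,n}(X)\big)\ \ge\ 1-\alpha ,$$ where the probability is over both folds and the test unit. If A2 holds, then moreover, for every $\epsilon>0$, $$\lim_{N,n\to\infty}\ \mathbb P_{X\sim P_X}\Big(\mathbb P\big(Y(1)\in\hat C_{N,n}(X)\mid X\big)\le 1-\alpha-\epsilon\Big)=0 ,$$ where the inner probability is over both folds and the test outcome, given the test covariate. Here $N$ and $n$ tend to infinity jointly. -/

import Mathlib

open MeasureTheory ProbabilityTheory Filter Topology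
open scoped ENNReal

namespace WeightedCQR

/-! ### Quantiles -/

/-- The `β`-th quantile `inf {z : F z ≥ β}` of a distribution `μ` on the line or on the extended
line, where `F z = μ (-∞, z]` is its cumulative distribution function. -/
noncomputable def quantile {R : Type*} [MeasurableSpace R] [Preorder R] [InfSet R]
    (β : ℝ) (μ : Measure R) : R :=
  sInf {z : R | ENNReal.ofReal β ≤ μ (Set.Iic z)}

/-! ### The potential outcome population -/

section Population

variable {Ω 𝒳 : Type*} [MeasurableSpace Ω] [MeasurableSpace 𝒳]

/-- The observed outcome (SUTVA): `Y(1)` for treated units and `Y(0)` for the others. -/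
def observedOutcome (T : Ω → Bool) (Y1 Y0 : Ω → ℝ) (ω : Ω) : ℝ :=
  if T ω = true then Y1 ω else Y0 ω

/-- The conditional law of a random element `Z` given `T = 1`. -/
noncomputable def treatedLaw {E : Type*} [MeasurableSpace E] (P : Measure Ω) (T : Ω → Bool)
    (Z : Ω → E) : Measure E :=
  (ProbabilityTheory.cond P {ω | T ω = true}).map Z

/-- The propensity score `e(x) = P(T = 1 | X = x)`. -/
noncomputable def propensity (P : Measure Ω) [IsFiniteMeasure P] (T : Ω → Bool) (X : Ω → 𝒳)
    (x : 𝒳) : ℝ≥0∞ :=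
  condDistrib T X P x {true}

/-- The conditional quantile `q_β(x)`: the `β`-th quantile of the law of `Y` given `X = x`. -/
noncomputable def condQuantile (P : Measure Ω) [IsFiniteMeasure P] (X : Ω → 𝒳) (Y : Ω → ℝ)
    (β : ℝ) (x : 𝒳) : ℝ :=
  quantile β (condDistrib Y X P x)

/-- On the set `S` the distribution `μ` has a Lebesgue density with values in `[b₁, b₂]`. -/
def HasDensityIn (μ : Measure ℝ) (S : Set ℝ) (b₁ b₂ : ℝ) : Prop :=
  ∃ p : ℝ → ℝ≥0∞, Measurable p ∧ μ.restrict S = (volume.restrict S).withDensity p ∧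
    ∀ y ∈ S, ENNReal.ofReal b₁ ≤ p y ∧ p y ≤ ENNReal.ofReal b₂

end Population

/-! ### Weighted split-CQR -/

section Algorithm

variable {𝒳 : Type*} {n : ℕ}

/-- The conformity score `max (q̂_lo(X) - Y, Y - q̂_hi(X))` of a point `(X, Y)`. -/
def score (qlo qhi : 𝒳 → ℝ) (z : 𝒳 × ℝ) : ℝ :=
  max (qlo z.1 - z.2) (z.2 - qhi z.1)

/-- The normalized weight of the `i`-th calibration point. It is `0` when `w x = ∞` (in `ℝ≥0∞`,
`a / ∞ = 0`). -/
noncomputable def normWeight (w : 𝒳 → ℝ≥0∞) (ca : Fin n → 𝒳 × ℝ) (x : 𝒳) (i : Fin n) : ℝ≥0∞ :=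
  w (ca i).1 / (∑ j, w (ca j).1 + w x)

open Classical in
/-- The normalized weight of the point at infinity, with the convention that it is `1` when
`w x = ∞`. -/
noncomputable def normWeightTop (w : 𝒳 → ℝ≥0∞) (ca : Fin n → 𝒳 × ℝ) (x : 𝒳) : ℝ≥0∞ :=
  if w x = ∞ then 1 else w x / (∑ j, w (ca j).1 + w x)

/-- The weighted distribution of the calibration scores, with an additional atom at `+∞`. -/
noncomputable def scoreLaw (qlo qhi : 𝒳 → ℝ) (w : 𝒳 → ℝ≥0∞) (ca : Fin n → 𝒳 × ℝ) (x : 𝒳) :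
    Measure EReal :=
  ∑ i, normWeight w ca x i • Measure.dirac ((score qlo qhi (ca i) : ℝ) : EReal)
    + normWeightTop w ca x • Measure.dirac (⊤ : EReal)

/-- The correction `η(x)`: the `(1 - α)`-th quantile of the weighted distribution of the scores. -/
noncomputable def eta (α : ℝ) (qlo qhi : 𝒳 → ℝ) (w : 𝒳 → ℝ≥0∞) (ca : Fin n → 𝒳 × ℝ)
    (x : 𝒳) : EReal :=
  quantile (1 - α) (scoreLaw qlo qhi w ca x)

/-- The prediction interval `[q̂_lo(x) - η(x), q̂_hi(x) + η(x)]` of weighted split-CQR with fitted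
quantiles `qlo`, `qhi`, fitted weight function `w` and calibration fold `ca`. -/
def interval (α : ℝ) (qlo qhi : 𝒳 → ℝ) (w : 𝒳 → ℝ≥0∞) (ca : Fin n → 𝒳 × ℝ) (x : 𝒳) : Set ℝ :=
  {y : ℝ | (qlo x : EReal) - eta α qlo qhi w ca x ≤ (y : EReal) ∧
    (y : EReal) ≤ (qhi x : EReal) + eta α qlo qhi w ca x}

end Algorithm

/-! ### Coverage

A fitted function takes the training fold as its first argument. The training fold, of law `τ`, the
`n` calibration points, i.i.d. of law `ρ`, and the test point are independent. The weight function
is `x ↦ 1 / ê(x)`, with the value `∞` where `ê(x) = 0`. -/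

section Coverage

variable {𝒵 𝒳 : Type*} [MeasurableSpace 𝒵] [MeasurableSpace 𝒳]

/-- The probability that the outcome of a test point `(X, Y)` of law `test` lies in `Ĉ(X)`; the
probability is over the training fold, the calibration fold and the test point. -/
noncomputable def coverage (τ : Measure 𝒵) (ρ test : Measure (𝒳 × ℝ)) (α : ℝ)
    (qlo qhi : 𝒵 → 𝒳 → ℝ) (ehat : 𝒵 → 𝒳 → ℝ≥0∞) (n : ℕ) : ℝ≥0∞ :=
  ((τ.prod (Measure.pi fun _ : Fin n => ρ)).prod test)
    {p | p.2.2 ∈ interval α (qlo p.1.1) (qhi p.1.1) (fun x => (ehat p.1.1 x)⁻¹) p.1.2 p.2.1}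

/-- The conditional probability, given that the test covariate is `x`, that the test outcome, of
conditional law `κ`, lies in `Ĉ(x)`; the probability is over the training fold, the calibration
fold and the test outcome. -/
noncomputable def conditionalCoverage (τ : Measure 𝒵) (ρ : Measure (𝒳 × ℝ)) (κ : Measure ℝ)
    (α : ℝ) (qlo qhi : 𝒵 → 𝒳 → ℝ) (ehat : 𝒵 → 𝒳 → ℝ≥0∞) (n : ℕ) (x : 𝒳) : ℝ≥0∞ :=
  ((τ.prod (Measure.pi fun _ : Fin n => ρ)).prod κ)
    {p | p.2 ∈ interval α (qlo p.1.1) (qhi p.1.1) (fun x' => (ehat p.1.1 x')⁻¹) p.1.2 x}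

end Coverage

/-! ### The two consistency conditions -/

section Conditions

variable {Ω 𝒳 𝒮 : Type*} [MeasurableSpace Ω] [MeasurableSpace 𝒳] [MeasurableSpace 𝒮]

/-- The absolute difference `|a - b|` of two extended nonnegative numbers. -/
noncomputable def absDiff (a b : ℝ≥0∞) : ℝ≥0∞ := (a - b) + (b - a)

/-- The inverse of the estimated propensity score is consistent in `L¹`:
`E |1 / ê_N(X) - 1 / e(X)| → 0`, where `X` follows the law of the covariates of treated units and
is independent of the training fold. -/
def PropensityConsistent (P : Measure Ω) [IsFiniteMeasure P] (X : Ω → 𝒳) (T : Ω → Bool)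
    (τ : (N : ℕ) → Measure (Fin N → 𝒮)) (ehat : (N : ℕ) → (Fin N → 𝒮) → 𝒳 → ℝ≥0∞) : Prop :=
  Tendsto
    (fun N => ∫⁻ z, ∫⁻ x, absDiff (ehat N z x)⁻¹ (propensity P T X x)⁻¹ ∂(treatedLaw P T X) ∂(τ N))
    atTop (𝓝 0)

/-- The larger of the errors of the two estimated conditional quantiles of `Y` at `x`. -/
noncomputable def quantileError (P : Measure Ω) [IsFiniteMeasure P] (X : Ω → 𝒳) (Y : Ω → ℝ)
    (αlo αhi : ℝ) (qlo qhi : 𝒳 → ℝ) (x : 𝒳) : ℝ :=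
  max |qlo x - condQuantile P X Y αlo x| |qhi x - condQuantile P X Y αhi x|

/-- The estimated conditional quantiles are consistent in a weighted sense: the levels differ by
`1 - α`; the conditional law of `Y` given `X = x` has a density with values in `[b₁, b₂]` within
distance `r` of both quantiles; `limsup E[1 / ê_N(X) ^ (1 + δ)] < ∞`; and `E[H_N(X) / ê_N(X)]` and
`E[H_N(X) / e(X)]` tend to `0`. Here `X` follows the law of the covariates of treated units and is
independent of the training fold. -/
def QuantileConsistent (P : Measure Ω) [IsFiniteMeasure P] (X : Ω → 𝒳) (T : Ω → Bool) (Y : Ω → ℝ)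
    (α αlo αhi : ℝ) (τ : (N : ℕ) → Measure (Fin N → 𝒮))
    (qlo qhi : (N : ℕ) → (Fin N → 𝒮) → 𝒳 → ℝ)
    (ehat : (N : ℕ) → (Fin N → 𝒮) → 𝒳 → ℝ≥0∞) : Prop :=
  αhi - αlo = 1 - α ∧
  (∃ r b₁ b₂ : ℝ, 0 < r ∧ 0 < b₁ ∧ 0 < b₂ ∧ ∀ᵐ x ∂(P.map X),
    HasDensityIn (condDistrib Y X P x)
      (Set.Icc (condQuantile P X Y αlo x - r) (condQuantile P X Y αlo x + r) ∪
        Set.Icc (condQuantile P X Y αhi x - r) (condQuantile P X Y αhi x + r)) b₁ b₂) ∧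
  (∃ δ : ℝ, 0 < δ ∧
    limsup (fun N => ∫⁻ z, ∫⁻ x, (ehat N z x)⁻¹ ^ (1 + δ) ∂(treatedLaw P T X) ∂(τ N)) atTop < ∞) ∧
  Tendsto (fun N => ∫⁻ z, ∫⁻ x,
      ENNReal.ofReal (quantileError P X Y αlo αhi (qlo N z) (qhi N z) x) / ehat N z x
      ∂(treatedLaw P T X) ∂(τ N)) atTop (𝓝 0) ∧
  Tendsto (fun N => ∫⁻ z, ∫⁻ x,
      ENNReal.ofReal (quantileError P X Y αlo αhi (qlo N z) (qhi N z) x) / propensity P T X x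
      ∂(treatedLaw P T X) ∂(τ N)) atTop (𝓝 0)

end Conditions

end WeightedCQR

/-! Let μ be the law of X given T = 1 and κ the conditional law of Y(1) given X. By ignorability the
calibration points have law `μ ⊗ₘ κ`; the test point has law `P_X ⊗ₘ κ`, and dP_X/dμ = P(T = 1)/e.
This is covariate shift with weight proportional to 1/e. An outcome is missed only if its score
exceeds η(x), and then the calibration scores below it carry a proportion of at least 1 - α of the
total weight, test weight included.

Under A1, weighted exchangeability applies. In any configuration of n + 1 weighted points, those
with a proportion of at least a of the weight strictly below them carry at most 1 - a of it
(`sum_weight_below_le`). By symmetry, a test point drawn with density proportional to 1/ê is missed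
with probability at most α (`lintegral_mostWeightBelow_le`). Passing from 1/ê to 1/e costs at most 2
P(T = 1) E₁|1/ê - 1/e|, whatever n is (`le_coverage_add_absDiff`).

Under A2 the weights need not be consistent. Fix a small t > 0. Where H ≤ t/2, scores below -t have
conditional mass at most 1 - α - c, so once E₁[H/ê] is small they carry on average less than 1 - α
of the weight. A truncated law of large numbers, using the moment of order 1 + δ, transfers this to
the sample (`measure_weight_proportion_le`), so with high probability η ≥ -t at all x at once. A
miss then requires a score above -t; where H(x) ≤ t this has conditional probability at most α + 4
b₂ t, and H(X) > t is rare under P_X because E₁[H/e] → 0. The same argument at fixed x, followed by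
Markov's inequality in x, gives conditional coverage. -/

namespace WeightedCQR

/-! ### Ignorability and the change of measure between treated units and population -/

section Population

variable {Ω 𝒳 : Type*} [MeasurableSpace Ω] [MeasurableSpace 𝒳]
  {P : Measure Ω} {X : Ω → 𝒳} {T : Ω → Bool} {Y1 Y0 : Ω → ℝ}

lemma treatedLaw_apply (hT : Measurable T) {E : Type*} [MeasurableSpace E] {Z : Ω → E}
    (hZ : Measurable Z) {A : Set E} (hA : MeasurableSet A) :
    treatedLaw P T Z A = (P {ω | T ω = true})⁻¹ * P ({ω | T ω = true} ∩ Z ⁻¹' A) := by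
  rw [treatedLaw, Measure.map_apply hZ hA]
  exact cond_apply (hT (measurableSet_singleton true)) _ _

variable [IsProbabilityMeasure P]

lemma measurable_propensity : Measurable (propensity P T X) :=
  Kernel.measurable_coe _ (measurableSet_singleton _)

lemma propensity_le_one (x : 𝒳) : propensity P T X x ≤ 1 := prob_le_one

/-- Given X = x, the outcome Y(1) and T are independent, so the joint conditional mass is the
product of the propensity and the mass under the law of Y(1). -/
lemma measure_treated_inter [StandardBorelSpace Ω] (hX : Measurable X) (hT : Measurable T) (hY1 : Measurable Y1)
    (hY0 : Measurable Y0)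
    (h_ign : CondIndepFun (MeasurableSpace.comap X inferInstance) hX.comap_le
      (fun ω => (Y1 ω, Y0 ω)) T P) {A : Set (𝒳 × ℝ)} (hA : MeasurableSet A) :
    P ({ω | T ω = true} ∩ (fun ω => (X ω, Y1 ω)) ⁻¹' A) =
      ∫⁻ x, propensity P T X x * condDistrib Y1 X P x (Prod.mk x ⁻¹' A) ∂(P.map X) := by
  have h := h_ign.comp measurable_fst measurable_id
  rw [Function.id_comp] at h
  have h' := (condIndepFun_iff_map_prod_eq_prod_condDistrib_prod_condDistrib
    (hf := measurable_fst.comp (hY1.prodMk hY0)) (hg := hT) (hk := hX)).1 h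
  have hA' : MeasurableSet {q : 𝒳 × ℝ × Bool | q.2.2 = true ∧ (q.1, q.2.1) ∈ A} :=
    (measurableSet_eq_fun (by fun_prop) (by fun_prop)).inter
      ((measurable_fst.prodMk measurable_snd.fst) hA)
  have h2 := congrArg (fun m => m {q : 𝒳 × ℝ × Bool | q.2.2 = true ∧ (q.1, q.2.1) ∈ A}) h'
  rw [Measure.map_apply (by fun_prop) hA', Measure.bind_apply hA' (by fun_prop)] at h2
  refine h2.trans (lintegral_congr fun x => ?_)
  rw [Kernel.prod_apply, Kernel.prod_apply, Kernel.id_apply, Measure.dirac_prod,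
    Measure.map_apply (by fun_prop) hA']
  have : Prod.mk x ⁻¹' {q : 𝒳 × ℝ × Bool | q.2.2 = true ∧ (q.1, q.2.1) ∈ A} =
      (Prod.mk x ⁻¹' A) ×ˢ {true} := by
    ext ⟨y, t⟩; simp [and_comm]
  rw [this, Measure.prod_prod, mul_comm]
  rfl

lemma treatedLaw_covariate (hX : Measurable X) (hT : Measurable T) :
    treatedLaw P T X =
      (P {ω | T ω = true})⁻¹ • (P.map X).withDensity (propensity P T X) := by
  ext s hs
  rw [treatedLaw_apply hT hX hs, Measure.smul_apply, withDensity_apply _ hs, smul_eq_mul]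
  congr 1
  rw [Set.inter_comm]
  refine Eq.trans ?_ (setLIntegral_map hs measurable_propensity hX).symm
  exact (setLIntegral_preimage_condDistrib hX hT.aemeasurable (measurableSet_singleton true)
    hs).symm

lemma measure_treated (hX : Measurable X) (hT : Measurable T) :
    P {ω | T ω = true} = ∫⁻ x, propensity P T X x ∂(P.map X) := by
  rw [lintegral_map measurable_propensity hX, ← setLIntegral_univ, ← Set.preimage_univ (f := X)]
  refine Eq.trans ?_ (setLIntegral_preimage_condDistrib hX hT.aemeasurable
    (measurableSet_singleton true) MeasurableSet.univ).symm
  simp; rfl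

lemma measure_treated_ne_zero (hX : Measurable X) (hT : Measurable T)
    (h_pos : ∀ᵐ x ∂(P.map X), 0 < propensity P T X x) : P {ω | T ω = true} ≠ 0 := by
  rw [measure_treated hX hT, Ne, lintegral_eq_zero_iff measurable_propensity]
  intro h
  have : IsProbabilityMeasure (P.map X) := Measure.isProbabilityMeasure_map hX.aemeasurable
  obtain ⟨x, h1, h2⟩ := (h.and h_pos).exists
  exact h2.ne' h1

lemma isProbabilityMeasure_treatedLaw (hp : P {ω | T ω = true} ≠ 0)
    {E : Type*} [MeasurableSpace E] {Z : Ω → E} (hZ : Measurable Z) :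
    IsProbabilityMeasure (treatedLaw P T Z) := by
  have := cond_isProbabilityMeasure hp
  exact Measure.isProbabilityMeasure_map hZ.aemeasurable

lemma measurable_observedOutcome (hT : Measurable T) (hY1 : Measurable Y1)
    (hY0 : Measurable Y0) : Measurable (observedOutcome T Y1 Y0) :=
  Measurable.ite (hT (measurableSet_singleton true)) hY1 hY0

/-- Under ignorability, the law of `(X, Y(T))` given `T = 1` has the same conditional law of the
outcome as the population law of `(X, Y(1))`. -/
lemma treatedLaw_eq_compProd [StandardBorelSpace Ω] (hX : Measurable X) (hT : Measurable T) (hY1 : Measurable Y1)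
    (hY0 : Measurable Y0)
    (h_ign : CondIndepFun (MeasurableSpace.comap X inferInstance) hX.comap_le
      (fun ω => (Y1 ω, Y0 ω)) T P)
    (hp : P {ω | T ω = true} ≠ 0) :
    treatedLaw P T (fun ω => (X ω, observedOutcome T Y1 Y0 ω)) =
      treatedLaw P T X ⊗ₘ condDistrib Y1 X P := by
  have := isProbabilityMeasure_treatedLaw (P := P) hp hX
  ext A hA
  have hκ : Measurable fun x => condDistrib Y1 X P x (Prod.mk x ⁻¹' A) :=
    Kernel.measurable_kernel_prodMk_left hA
  rw [treatedLaw_apply hT (hX.prodMk (measurable_observedOutcome hT hY1 hY0)) hA,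
    Measure.compProd_apply hA, treatedLaw_covariate hX hT, lintegral_smul_measure,
    lintegral_withDensity_eq_lintegral_mul _ measurable_propensity hκ, smul_eq_mul]
  congr 1
  refine Eq.trans ?_ (measure_treated_inter hX hT hY1 hY0 h_ign hA)
  congr 1
  ext ω
  simp +contextual [observedOutcome]

/-- The population law of the covariates has density `P(T = 1) / e` with respect to their law
among the treated. -/
lemma map_eq_withDensity_treatedLaw (hX : Measurable X) (hT : Measurable T)
    (h_pos : ∀ᵐ x ∂(P.map X), 0 < propensity P T X x) :
    P.map X = (treatedLaw P T X).withDensity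
      fun x => P {ω | T ω = true} * (propensity P T X x)⁻¹ := by
  have hp := measure_treated_ne_zero hX hT h_pos
  have hm : Measurable (propensity P T X) := measurable_propensity
  ext s hs
  rw [withDensity_apply _ hs, treatedLaw_covariate hX hT, Measure.restrict_smul,
    lintegral_smul_measure, restrict_withDensity hs,
    lintegral_withDensity_eq_lintegral_mul _ hm (by fun_prop), smul_eq_mul,
    ← lintegral_const_mul _ (by fun_prop)]
  rw [← setLIntegral_one]
  refine lintegral_congr_ae (ae_restrict_of_ae ?_)
  filter_upwards [h_pos] with x hx
  have h1 : propensity P T X x ≠ ∞ := ((propensity_le_one x).trans_lt ENNReal.one_lt_top).ne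
  simp only [Pi.mul_apply]
  rw [mul_left_comm _ (P _), ENNReal.mul_inv_cancel hx.ne' h1, mul_one,
    ENNReal.inv_mul_cancel hp (measure_ne_top _ _)]

end Population

/-! ### From the correction η to proportions of weight -/

section Deterministic

variable {𝒳 : Type*} {n : ℕ}

/-- Below `⊤` the atom at infinity does not count. The quotient is 0 when its denominator is
infinite, so infinite weights need no separate treatment. -/
lemma scoreLaw_Iic (qlo qhi : 𝒳 → ℝ) (w : 𝒳 → ℝ≥0∞) (ca : Fin n → 𝒳 × ℝ) (x : 𝒳) {z : EReal}
    (hz : z < ⊤) :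
    scoreLaw qlo qhi w ca x (Set.Iic z) =
      (∑ i, if ((score qlo qhi (ca i) : ℝ) : EReal) ≤ z then w (ca i).1 else 0) /
        (∑ j, w (ca j).1 + w x) := by
  classical
  simp only [scoreLaw, normWeight, Measure.add_apply, Measure.finsetSum_apply,
    Measure.smul_apply, smul_eq_mul, Measure.dirac_apply' _ measurableSet_Iic]
  rw [Set.indicator_of_notMem (by simpa using hz.ne), mul_zero, add_zero]
  simp only [Set.indicator_apply, Set.mem_Iic, Pi.one_apply, mul_ite, mul_one, mul_zero,
    div_eq_mul_inv, Finset.sum_mul, ite_mul, zero_mul]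

/-- If the correction `η(x)` is below `s`, then the calibration scores below `s` carry a
proportion of at least `1 - α` of the total weight. -/
lemma le_sum_of_eta_lt {α : ℝ} {qlo qhi : 𝒳 → ℝ} {w : 𝒳 → ℝ≥0∞} {ca : Fin n → 𝒳 × ℝ} {x : 𝒳}
    {s : ℝ} (h : eta α qlo qhi w ca x < s) :
    ENNReal.ofReal (1 - α) * (∑ j, w (ca j).1 + w x) ≤
      ∑ i, if score qlo qhi (ca i) < s then w (ca i).1 else 0 := by
  obtain ⟨z, hz, hzs⟩ := sInf_lt_iff.1 h
  have hz' : z < ⊤ := hzs.trans (EReal.coe_lt_top s)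
  rw [Set.mem_ofPred_eq, scoreLaw_Iic _ _ _ _ _ hz'] at hz
  refine (ENNReal.mul_le_of_le_div hz).trans (Finset.sum_le_sum fun i _ => ?_)
  by_cases hi : ((score qlo qhi (ca i) : ℝ) : EReal) ≤ z
  · rw [if_pos hi, if_pos (EReal.coe_lt_coe_iff.1 (hi.trans_lt hzs))]
  · rw [if_neg hi]; exact zero_le

lemma mem_interval_of_score_le {α : ℝ} {qlo qhi : 𝒳 → ℝ} {w : 𝒳 → ℝ≥0∞} {ca : Fin n → 𝒳 × ℝ}
    {x : 𝒳} {y : ℝ} (h : ((score qlo qhi (x, y) : ℝ) : EReal) ≤ eta α qlo qhi w ca x) :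
    y ∈ interval α qlo qhi w ca x := by
  simp only [interval, Set.mem_ofPred_eq]
  generalize eta α qlo qhi w ca x = e at h
  induction e with
  | bot => simp at h
  | top => simp
  | coe e =>
    rw [EReal.coe_le_coe_iff, score, max_le_iff] at h
    norm_cast
    constructor <;> simp only at h <;> linarith [h.1, h.2]

/-- The form in which coverage is always proved: A1 takes for `s` the score of the test point
itself, A2 takes `s = -t`. -/
lemma mem_interval_of_score_le_of_not_le {α : ℝ} {qlo qhi : 𝒳 → ℝ} {w : 𝒳 → ℝ≥0∞}
    {ca : Fin n → 𝒳 × ℝ} {x : 𝒳} {y s : ℝ} (hs : score qlo qhi (x, y) ≤ s)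
    (h : ¬ ENNReal.ofReal (1 - α) * (∑ j, w (ca j).1 + w x) ≤
      ∑ i, if score qlo qhi (ca i) < s then w (ca i).1 else 0) :
    y ∈ interval α qlo qhi w ca x := by
  refine mem_interval_of_score_le ((EReal.coe_le_coe_iff.2 hs).trans ?_)
  by_contra hlt
  exact h (le_sum_of_eta_lt (not_le.1 hlt))

end Deterministic

/-! ### Weighted exchangeability and the cost of estimated weights -/

section Exchangeability

variable {E : Type*} {n : ℕ}

/-- Among the indices counted on the left, take one with minimal `v`. The points strictly below it
are not counted and carry at least the proportion `a`, which leaves at most `1 - a` for the counted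
ones. -/
lemma sum_weight_below_le {ι : Type*} [Fintype ι] {a : ℝ≥0∞} (ha : a < 1) (w : ι → ℝ≥0∞)
    (v : ι → ℝ) :
    (∑ i, if a * ∑ j, w j ≤ ∑ j, (if v j < v i then w j else 0) then w i else 0) ≤
      (1 - a) * ∑ i, w i := by
  classical
  set S := ∑ j, w j with hS
  by_cases hS' : S = ∞
  · rw [hS', ENNReal.mul_top (tsub_pos_of_lt ha).ne']; exact le_top
  set B : Finset ι := Finset.univ.filter
    fun i => a * S ≤ ∑ j, (if v j < v i then w j else 0) with hB
  rw [← Finset.sum_filter, ← hB]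
  rcases B.eq_empty_or_nonempty with h0 | h0
  · simp [h0]
  obtain ⟨i, hi, hmin⟩ := B.exists_min_image v h0
  have h1 : a * S ≤ ∑ j, (if v j < v i then w j else 0) := (Finset.mem_filter.1 hi).2
  rw [← Finset.sum_filter] at h1
  have hd : Disjoint B (Finset.univ.filter fun j => v j < v i) := by
    rw [Finset.disjoint_left]
    intro j hj hj'
    exact absurd (Finset.mem_filter.1 hj').2 (not_lt.2 (hmin j hj))
  have h2 : ∑ j ∈ B, w j + a * S ≤ S := by
    refine (add_le_add_right h1 _).trans ?_
    rw [← Finset.sum_union hd]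
    exact Finset.sum_le_sum_of_subset (Finset.subset_univ _)
  rw [ENNReal.sub_mul (fun _ _ => hS'), one_mul]
  exact ENNReal.le_sub_of_add_le_right (ENNReal.mul_ne_top (ha.trans ENNReal.one_lt_top).ne hS') h2

variable [MeasurableSpace E]

/-- The calibration points scoring less than the test point `z` carry a proportion of at least `a`
of the total weight. -/
def MostWeightBelow (a : ℝ≥0∞) (w : E → ℝ≥0∞) (v : E → ℝ) (ca : Fin n → E) (z : E) : Prop :=
  a * (∑ j, w (ca j) + w z) ≤ ∑ j, if v (ca j) < v z then w (ca j) else 0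

lemma measurableSet_mostWeightBelow {F : Type*} [MeasurableSpace F] (a : ℝ≥0∞)
    {w : F → E → ℝ≥0∞} (hw : Measurable (Function.uncurry w)) {v : F → E → ℝ}
    (hv : Measurable (Function.uncurry v)) :
    MeasurableSet {q : (F × (Fin n → E)) × E | MostWeightBelow a (w q.1.1) (v q.1.1) q.1.2 q.2} := by
  have hwi (j : Fin n) : Measurable fun q : (F × (Fin n → E)) × E => w q.1.1 (q.1.2 j) :=
    hw.comp (f := fun q : (F × (Fin n → E)) × E => (q.1.1, q.1.2 j)) (by fun_prop)
  have hwz : Measurable fun q : (F × (Fin n → E)) × E => w q.1.1 q.2 :=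
    hw.comp (f := fun q : (F × (Fin n → E)) × E => (q.1.1, q.2)) (by fun_prop)
  have hvi (j : Fin n) : Measurable fun q : (F × (Fin n → E)) × E => v q.1.1 (q.1.2 j) :=
    hv.comp (f := fun q : (F × (Fin n → E)) × E => (q.1.1, q.1.2 j)) (by fun_prop)
  have hvz : Measurable fun q : (F × (Fin n → E)) × E => v q.1.1 q.2 :=
    hv.comp (f := fun q : (F × (Fin n → E)) × E => (q.1.1, q.2)) (by fun_prop)
  refine measurableSet_le
    (((Finset.measurable_fun_sum _ fun j _ => hwi j).add hwz).const_mul a)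
    (Finset.measurable_fun_sum _ fun j _ => Measurable.ite (measurableSet_lt (hvi j) hvz) (hwi j)
      measurable_const)

lemma measurableSet_mostWeightBelow_prod (a : ℝ≥0∞)
    {w : E → ℝ≥0∞} (hw : Measurable w) {v : E → ℝ} (hv : Measurable v) :
    MeasurableSet {q : (Fin n → E) × E | MostWeightBelow a w v q.1 q.2} :=
  (measurableSet_mostWeightBelow (F := Unit) a (w := fun _ => w) (v := fun _ => v)
    (hw.comp measurable_snd) (hv.comp measurable_snd)).preimage
    (f := fun q : (Fin n → E) × E => (((), q.1), q.2)) (by fun_prop)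

open Classical in
/-- Weighted exchangeability: if the test point is drawn with density proportional to the weights
`w`, then `MostWeightBelow a` has probability at most `1 - a`. -/
lemma lintegral_mostWeightBelow_le (ρ : Measure E) [IsProbabilityMeasure ρ] {a : ℝ≥0∞} (ha : a < 1)
    {w : E → ℝ≥0∞} (hw : Measurable w) {v : E → ℝ} (hv : Measurable v) :
    ∫⁻ ca, ∫⁻ z, (if MostWeightBelow a w v ca z then w z else 0) ∂ρ
        ∂(Measure.pi fun _ : Fin n => ρ) ≤ (1 - a) * ∫⁻ z, w z ∂ρ := by
  set I := ∫⁻ ca, ∫⁻ z, (if MostWeightBelow a w v ca z then w z else 0) ∂ρ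
        ∂(Measure.pi fun _ : Fin n => ρ) with hI
  have hmeas : Measurable fun q : E × (Fin n → E) =>
      if MostWeightBelow a w v q.2 q.1 then w q.1 else 0 :=
    Measurable.ite ((measurableSet_mostWeightBelow_prod a hw hv).preimage measurable_swap)
      (hw.comp measurable_fst) measurable_const
  -- Any of the `n + 1` i.i.d. points may play the test point. The term `j = i` drops out of the
  -- weight below, since `v (ω i) < v (ω i)` is false.
  have key (i : Fin (n + 1)) :
      ∫⁻ ω, (if a * ∑ j, w (ω j) ≤ ∑ j, (if v (ω j) < v (ω i) then w (ω j) else 0)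
        then w (ω i) else 0) ∂(Measure.pi fun _ : Fin (n + 1) => ρ) = I := by
    rw [hI, ← lintegral_prod_symm' _ hmeas,
      ← (measurePreserving_piFinSuccAbove (fun _ : Fin (n + 1) => ρ) i).lintegral_comp hmeas]
    refine lintegral_congr fun ω => ?_
    simp only [MostWeightBelow, MeasurableEquiv.piFinSuccAbove_apply, Fin.insertNthEquiv_symm_apply,
      Fin.sum_univ_succAbove _ i, lt_irrefl, if_false, zero_add, Fin.removeNth]
    rw [add_comm (w (ω i))]
  have hwe (i : Fin (n + 1)) : Measurable fun ω : Fin (n + 1) → E => w (ω i) :=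
    hw.comp (measurable_pi_apply i)
  have hve (i : Fin (n + 1)) : Measurable fun ω : Fin (n + 1) → E => v (ω i) :=
    hv.comp (measurable_pi_apply i)
  have hle : ∑ _i : Fin (n + 1), I ≤ ∑ _i : Fin (n + 1), (1 - a) * ∫⁻ z, w z ∂ρ := by
    calc ∑ i : Fin (n + 1), I
        = ∫⁻ ω, ∑ i, (if a * ∑ j, w (ω j) ≤ ∑ j, (if v (ω j) < v (ω i) then w (ω j) else 0)
            then w (ω i) else 0) ∂(Measure.pi fun _ : Fin (n + 1) => ρ) := by
          rw [lintegral_finsetSum _ fun i _ => ?_]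
          · exact Finset.sum_congr rfl fun i _ => (key i).symm
          · exact Measurable.ite (measurableSet_le
              ((Finset.measurable_fun_sum _ fun j _ => hwe j).const_mul a)
              (Finset.measurable_fun_sum _ fun j _ => Measurable.ite
                (measurableSet_lt (hve j) (hve i)) (hwe j) measurable_const))
              (hwe i) measurable_const
      _ ≤ ∫⁻ ω, (1 - a) * ∑ i, w (ω i) ∂(Measure.pi fun _ : Fin (n + 1) => ρ) :=
          lintegral_mono fun ω => sum_weight_below_le ha (fun i => w (ω i)) (fun i => v (ω i))
      _ = ∑ _i : Fin (n + 1), (1 - a) * ∫⁻ z, w z ∂ρ := by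
          rw [lintegral_const_mul _ (Finset.measurable_fun_sum _ fun j _ => hwe j),
            lintegral_finsetSum _ fun i _ => hwe i, Finset.mul_sum]
          refine Finset.sum_congr rfl fun i _ => ?_
          rw [(measurePreserving_eval (fun _ : Fin (n + 1) => ρ) i).lintegral_comp hw]
  rw [Finset.sum_const, Finset.sum_const, Finset.card_univ, Fintype.card_fin, nsmul_eq_mul,
    nsmul_eq_mul] at hle
  exact (ENNReal.mul_le_mul_iff_right (by simp) (ENNReal.natCast_ne_top _)).1 hle

lemma absDiff_comm (a b : ℝ≥0∞) : absDiff a b = absDiff b a := add_comm _ _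

lemma le_add_absDiff (a b : ℝ≥0∞) : a ≤ b + absDiff a b :=
  le_add_tsub.trans (add_le_add_right le_self_add _)

/-- Coverage with estimated weights `w` in place of the true weights `w₀`. -/
lemma le_lintegral_not_mostWeightBelow (ρ : Measure E) [IsProbabilityMeasure ρ] {a c : ℝ≥0∞}
    (ha : a < 1) {w w₀ : E → ℝ≥0∞} (hw : Measurable w) (hw₀ : Measurable w₀) {v : E → ℝ}
    (hv : Measurable v) (hfin : ∫⁻ z, w z ∂ρ < ∞) (hc : c * ∫⁻ z, w₀ z ∂ρ = 1) :
    a ≤ ((Measure.pi fun _ : Fin n => ρ).prod (ρ.withDensity fun z => c * w₀ z))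
        {q | ¬ MostWeightBelow a w v q.1 q.2} +
      2 * c * ∫⁻ z, absDiff (w z) (w₀ z) ∂ρ := by
  classical
  set D := ∫⁻ z, absDiff (w z) (w₀ z) ∂ρ with hD
  set π := Measure.pi fun _ : Fin n => ρ
  have hm := (measurableSet_mostWeightBelow_prod (n := n) a hw hv)
  have hmc : MeasurableSet {q : (Fin n → E) × E | ¬ MostWeightBelow a w v q.1 q.2} := hm.compl
  have hmD : Measurable fun z => absDiff (w z) (w₀ z) := (hw.sub hw₀).add (hw₀.sub hw)
  have hms (ca : Fin n → E) : MeasurableSet {z | MostWeightBelow a w v ca z} :=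
    hm.preimage (measurable_const.prodMk measurable_id)
  set G := ∫⁻ ca, ∫⁻ z, (if ¬ MostWeightBelow a w v ca z then w z else 0) ∂ρ ∂π with hG
  set G₀ := ∫⁻ ca, ∫⁻ z, (if ¬ MostWeightBelow a w v ca z then w₀ z else 0) ∂ρ ∂π with hG₀
  have h0 : (π.prod (ρ.withDensity fun z => c * w₀ z)) {q | ¬ MostWeightBelow a w v q.1 q.2} =
      c * G₀ := by
    have : SFinite (ρ.withDensity fun z => c * w₀ z) := inferInstance
    rw [Measure.prod_apply hmc, hG₀, ← lintegral_const_mul']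
    · refine lintegral_congr fun ca => ?_
      have hc' : MeasurableSet {z | ¬ MostWeightBelow a w v ca z} := (hms ca).compl
      rw [withDensity_apply _ (measurable_prodMk_left hmc),
        ← lintegral_const_mul _ (Measurable.ite hc' hw₀ measurable_const),
        ← lintegral_indicator (measurable_prodMk_left hmc)]
      refine lintegral_congr fun z => ?_
      simp [Set.indicator_apply]
    -- `c = ∞` is incompatible with `c * ∫ w₀ = 1`.
    · rintro rfl
      rcases eq_or_ne (∫⁻ z, w₀ z ∂ρ) 0 with h | h
      · simp [h] at hc
      · simp [ENNReal.top_mul h] at hc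
  have h1 : ∫⁻ z, w z ∂ρ ≤ (1 - a) * ∫⁻ z, w z ∂ρ + G := by
    calc ∫⁻ z, w z ∂ρ = ∫⁻ _ca, ∫⁻ z, w z ∂ρ ∂π := by simp
      _ ≤ ∫⁻ ca, ∫⁻ z, (if MostWeightBelow a w v ca z then w z else 0) ∂ρ ∂π + G := by
          rw [hG, ← lintegral_add_left]
          · refine lintegral_mono fun ca => ?_
            rw [← lintegral_add_left (Measurable.ite (hms ca) hw measurable_const)]
            refine lintegral_mono fun z => ?_
            by_cases h : MostWeightBelow a w v ca z <;> simp [h]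
          · exact Measurable.lintegral_prod_right' (f := fun q : (Fin n → E) × E =>
              if MostWeightBelow a w v q.1 q.2 then w q.2 else 0)
              (Measurable.ite hm (hw.comp measurable_snd) measurable_const)
      _ ≤ _ := add_le_add_left (lintegral_mostWeightBelow_le ρ ha hw hv) _
  -- Integrability of the estimated weight is needed here, to cancel `(1 - a) * ∫ w`.
  have h2 : a * ∫⁻ z, w z ∂ρ ≤ G := by
    have e : ∫⁻ z, w z ∂ρ = (1 - a) * ∫⁻ z, w z ∂ρ + a * ∫⁻ z, w z ∂ρ := by
      rw [← add_mul, tsub_add_cancel_of_le ha.le, one_mul]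
    have hne : (1 - a) * ∫⁻ z, w z ∂ρ ≠ ∞ :=
      ENNReal.mul_ne_top (ENNReal.sub_ne_top ENNReal.one_ne_top) hfin.ne
    exact (ENNReal.add_le_add_iff_left hne).1 (e.symm.le.trans h1)
  -- The weights are exchanged twice, on the covered event here and in the total mass in `h4`; this
  -- is the factor 2 in the error.
  have h3 : G ≤ G₀ + D := by
    calc G ≤ ∫⁻ ca, (∫⁻ z, (if ¬ MostWeightBelow a w v ca z then w₀ z else 0) ∂ρ + D) ∂π := by
          refine lintegral_mono fun ca => ?_
          rw [hD, ← lintegral_add_right _ hmD]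
          refine lintegral_mono fun z => ?_
          by_cases h : MostWeightBelow a w v ca z
          · simp [h]
          · simpa [h] using le_add_absDiff _ _
      _ = G₀ + D := by rw [lintegral_add_right _ measurable_const, hG₀, lintegral_const, measure_univ, mul_one]
  have h4 : ∫⁻ z, w₀ z ∂ρ ≤ ∫⁻ z, w z ∂ρ + D := by
    rw [hD, ← lintegral_add_right _ hmD]
    refine lintegral_mono fun z => ?_
    rw [absDiff_comm]
    exact le_add_absDiff _ _
  rw [h0]
  calc a = c * (a * ∫⁻ z, w₀ z ∂ρ) := by rw [mul_left_comm, hc, mul_one]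
    _ ≤ c * (a * (∫⁻ z, w z ∂ρ + D)) := by gcongr
    _ ≤ c * ((G₀ + D) + 1 * D) := by
        rw [mul_add]
        gcongr
        exact h2.trans h3
    _ = _ := by ring

end Exchangeability

/-! ### Quantiles and the mass near them under a bounded density -/

section Quantiles

variable {μ : Measure ℝ} [IsProbabilityMeasure μ] {β : ℝ}

lemma ofReal_le_measure_Iic_iff (z : ℝ) :
    ENNReal.ofReal β ≤ μ (Set.Iic z) ↔ β ≤ cdf μ z := by
  rw [← ofReal_cdf, ENNReal.ofReal_le_ofReal_iff (cdf_nonneg μ z)]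

/-- Right continuity of the cdf makes the infimum attained. The restriction on `β` makes the set
nonempty and bounded below, so that `sInf` is a true infimum. -/
lemma quantile_le_iff (hβ : β ∈ Set.Ioo (0 : ℝ) 1) {t : ℝ} :
    quantile β μ ≤ t ↔ ENNReal.ofReal β ≤ μ (Set.Iic t) := by
  rw [quantile]
  simp only [ofReal_le_measure_Iic_iff]
  have hne : {z | β ≤ cdf μ z}.Nonempty :=
    (((tendsto_cdf_atTop μ).eventually_const_lt hβ.2).exists).imp fun _ h => le_of_lt h
  have hbdd : BddBelow {z | β ≤ cdf μ z} := by
    obtain ⟨m, hm⟩ := ((tendsto_cdf_atBot μ).eventually_lt_const hβ.1).exists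
    exact ⟨m, fun z hz => le_of_not_gt fun h => not_le.2 hm (le_trans hz (monotone_cdf μ h.le))⟩
  refine ⟨fun h => ?_, fun h => csInf_le hbdd h⟩
  have hc : Tendsto (cdf μ) (𝓝[>] t) (𝓝 (cdf μ t)) :=
    ((cdf μ).right_continuous t).mono_left (nhdsWithin_mono _ Set.Ioi_subset_Ici_self)
  refine ge_of_tendsto hc ?_
  filter_upwards [self_mem_nhdsWithin] with s hs
  obtain ⟨z, hz, hzs⟩ := exists_lt_of_csInf_lt hne (h.trans_lt hs)
  exact le_trans hz (monotone_cdf μ hzs.le)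

lemma measure_Ioi_quantile_le (hβ : β ∈ Set.Ioo (0 : ℝ) 1) :
    μ (Set.Ioi (quantile β μ)) ≤ ENNReal.ofReal (1 - β) := by
  have h : ENNReal.ofReal β ≤ μ (Set.Iic (quantile β μ)) := (quantile_le_iff hβ).1 le_rfl
  rw [← Set.compl_Iic, prob_compl_eq_one_sub measurableSet_Iic, ENNReal.ofReal_sub _ hβ.1.le,
    ENNReal.ofReal_one]
  exact tsub_le_tsub_left h _

lemma measure_Iio_quantile_le (hβ : β ∈ Set.Ioo (0 : ℝ) 1) :
    μ (Set.Iio (quantile β μ)) ≤ ENNReal.ofReal β := by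
  obtain ⟨u, hu, hlt, hlim⟩ := exists_seq_strictMono_tendsto (quantile β μ)
  rw [← iUnion_Iic_eq_Iio_of_lt_of_tendsto hlt hlim,
    Monotone.measure_iUnion fun i j hij => Set.Iic_subset_Iic.2 (hu.monotone hij)]
  refine iSup_le fun i => ?_
  by_contra h
  exact absurd ((quantile_le_iff hβ).2 (not_le.1 h).le) (not_le.2 (hlt i))

variable {S A : Set ℝ} {b₁ b₂ : ℝ}

omit [IsProbabilityMeasure μ] in
lemma HasDensityIn.measure_eq {p : ℝ → ℝ≥0∞}
    (hp : μ.restrict S = (volume.restrict S).withDensity p)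
    (hA : MeasurableSet A) (hAS : A ⊆ S) : μ A = ∫⁻ y in A, p y := by
  have := congrArg (fun m => m A) hp
  simpa [Measure.restrict_apply hA, withDensity_apply _ hA, Measure.restrict_restrict hA,
    Set.inter_eq_left.2 hAS] using this

omit [IsProbabilityMeasure μ] in
lemma HasDensityIn.measure_le (h : HasDensityIn μ S b₁ b₂) (hA : MeasurableSet A) (hAS : A ⊆ S) :
    μ A ≤ ENNReal.ofReal b₂ * volume A := by
  obtain ⟨p, -, hp, hb⟩ := h
  rw [HasDensityIn.measure_eq hp hA hAS, ← setLIntegral_const]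
  exact setLIntegral_mono' hA fun y hy => (hb y (hAS hy)).2

omit [IsProbabilityMeasure μ] in
lemma HasDensityIn.le_measure (h : HasDensityIn μ S b₁ b₂) (hA : MeasurableSet A) (hAS : A ⊆ S) :
    ENNReal.ofReal b₁ * volume A ≤ μ A := by
  obtain ⟨p, -, hp, hb⟩ := h
  rw [HasDensityIn.measure_eq hp hA hAS, ← setLIntegral_const]
  exact setLIntegral_mono' hA fun y hy => (hb y (hAS hy)).1

lemma measure_Iio_quantile_add_le (hβ : β ∈ Set.Ioo (0 : ℝ) 1) {s : ℝ} (hs : 0 ≤ s) (hb₂ : 0 < b₂)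
    (h : HasDensityIn μ S b₁ b₂) (hS : Set.Icc (quantile β μ) (quantile β μ + s) ⊆ S) :
    μ (Set.Iio (quantile β μ + s)) ≤ ENNReal.ofReal (β + b₂ * s) := by
  have hsub : Set.Iio (quantile β μ + s) ⊆
      Set.Iio (quantile β μ) ∪ Set.Icc (quantile β μ) (quantile β μ + s) := fun y hy =>
    (lt_or_ge y (quantile β μ)).imp id fun h => ⟨h, le_of_lt hy⟩
  refine (measure_mono hsub).trans ((measure_union_le _ _).trans ?_)
  rw [ENNReal.ofReal_add hβ.1.le (mul_nonneg hb₂.le hs), ENNReal.ofReal_mul hb₂.le]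
  refine add_le_add (measure_Iio_quantile_le hβ)
    ((h.measure_le measurableSet_Icc hS).trans_eq ?_)
  rw [Real.volume_Icc, add_sub_cancel_left]

lemma measure_Ioi_quantile_sub_le (hβ : β ∈ Set.Ioo (0 : ℝ) 1) {s : ℝ} (hs : 0 ≤ s) (hb₂ : 0 < b₂)
    (h : HasDensityIn μ S b₁ b₂) (hS : Set.Icc (quantile β μ - s) (quantile β μ) ⊆ S) :
    μ (Set.Ioi (quantile β μ - s)) ≤ ENNReal.ofReal (1 - β + b₂ * s) := by
  have hsub : Set.Ioi (quantile β μ - s) ⊆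
      Set.Ioi (quantile β μ) ∪ Set.Icc (quantile β μ - s) (quantile β μ) := fun y hy =>
    (lt_or_ge (quantile β μ) y).imp id fun h => ⟨le_of_lt hy, h⟩
  refine (measure_mono hsub).trans ((measure_union_le _ _).trans ?_)
  rw [ENNReal.ofReal_add (sub_nonneg.2 hβ.2.le) (mul_nonneg hb₂.le hs), ENNReal.ofReal_mul hb₂.le]
  refine add_le_add (measure_Ioi_quantile_le hβ)
    ((h.measure_le measurableSet_Icc hS).trans_eq ?_)
  rw [Real.volume_Icc, sub_sub_cancel]

/-- The mass between two quantiles drops by a fixed amount when the lower end is moved up. -/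
lemma measure_Ioo_quantile_add_le {βlo βhi : ℝ} (hlo : βlo ∈ Set.Ioo (0 : ℝ) 1)
    (hhi : βhi ∈ Set.Ioo (0 : ℝ) 1) {s : ℝ} (hs : 0 ≤ s) (hb₁ : 0 < b₁)
    (h : HasDensityIn μ S b₁ b₂)
    (hS : Set.Icc (quantile βlo μ) (quantile βlo μ + s) ⊆ S) :
    μ (Set.Ioo (quantile βlo μ + s) (quantile βhi μ)) + ENNReal.ofReal (min (b₁ * s) (βhi - βlo)) ≤
      ENNReal.ofReal (βhi - βlo) := by
  set ql := quantile βlo μ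
  set qh := quantile βhi μ
  -- The shifted lower end may pass the upper quantile; the interval is then empty and the second
  -- term of the minimum gives the bound.
  rcases le_or_gt qh (ql + s) with hq | hq
  · rw [Set.Ioo_eq_empty (not_lt.2 hq), measure_empty, zero_add]
    exact ENNReal.ofReal_le_ofReal (min_le_right _ _)
  · have h1 : ENNReal.ofReal βlo ≤ μ (Set.Iic ql) := (quantile_le_iff (μ := μ) hlo).1 le_rfl
    have h2 : ENNReal.ofReal (b₁ * s) ≤ μ (Set.Ioc ql (ql + s)) := by
      refine le_trans (le_of_eq ?_)
        (h.le_measure measurableSet_Ioc (Set.Ioc_subset_Icc_self.trans hS))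
      rw [Real.volume_Ioc, add_sub_cancel_left, ENNReal.ofReal_mul hb₁.le]
    have h3 : μ (Set.Iic ql) + μ (Set.Ioc ql (ql + s)) + μ (Set.Ioo (ql + s) qh) ≤
        ENNReal.ofReal βhi := by
      refine le_trans (le_of_eq ?_) (measure_Iio_quantile_le (μ := μ) hhi)
      rw [← measure_union _ measurableSet_Ioc, Set.Iic_union_Ioc_eq_Iic (by linarith),
        ← measure_union _ measurableSet_Ioo, Set.Iic_union_Ioo_eq_Iio hq]
      · exact Set.disjoint_left.2 fun y hy hy' => absurd hy'.1 (not_lt.2 hy)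
      · exact Set.disjoint_left.2 fun y hy hy' => absurd hy'.1 (not_lt.2 hy)
    -- The order of the levels must be known because `ENNReal.ofReal` truncates `βhi - βlo` at 0.
    have hlt : βlo ≤ βhi := by
      rw [← ENNReal.ofReal_le_ofReal_iff hhi.1.le]
      exact h1.trans (le_trans (by rw [add_assoc]; exact le_self_add) h3)
    refine ENNReal.le_of_add_le_add_left (a := ENNReal.ofReal βlo) ENNReal.ofReal_ne_top ?_
    rw [← ENNReal.ofReal_add hlo.1.le (sub_nonneg.2 hlt), add_sub_cancel]
    refine le_trans ?_ h3
    rw [add_assoc, add_comm (μ (Set.Ioo _ _))]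
    gcongr
    exact (ENNReal.ofReal_le_ofReal (min_le_left _ _)).trans h2

lemma measurable_quantile_kernel {𝒳 : Type*} [MeasurableSpace 𝒳] (κ : Kernel 𝒳 ℝ)
    [IsMarkovKernel κ] (hβ : β ∈ Set.Ioo (0 : ℝ) 1) : Measurable fun x => quantile β (κ x) := by
  refine measurable_of_Iic fun t => ?_
  have : (fun x => quantile β (κ x)) ⁻¹' Set.Iic t = {x | ENNReal.ofReal β ≤ κ x (Set.Iic t)} := by
    ext x
    exact quantile_le_iff hβ
  rw [this]
  exact measurableSet_le measurable_const (Kernel.measurable_coe κ measurableSet_Iic)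

end Quantiles

/-! ### A weak law for weighted proportions -/

section Concentration

variable {E : Type*} [MeasurableSpace E] {n : ℕ} (ρ : Measure E) [IsProbabilityMeasure ρ]

/-- Chebyshev's inequality: variances add under the product measure, and each is at most `B ^ 2`. -/
lemma measure_sum_ge_le {h : E → ℝ} (hm : Measurable h) {B : ℝ} (hB : ∀ e, |h e| ≤ B) {t : ℝ}
    (ht : 0 < t) (hn : 0 < n) :
    (Measure.pi fun _ : Fin n => ρ) {ca | n * (∫ e, h e ∂ρ + t) ≤ ∑ j, h (ca j)} ≤
      ENNReal.ofReal (B ^ 2 / (n * t ^ 2)) := by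
  have hn' : (0 : ℝ) < n := Nat.cast_pos.2 hn
  have hL : MemLp h 2 ρ := MemLp.of_bound hm.aestronglyMeasurable B (ae_of_all _ hB)
  have hLi (j : Fin n) : MemLp (fun ca : Fin n → E => h (ca j)) 2 (Measure.pi fun _ => ρ) :=
    hL.comp_measurePreserving (measurePreserving_eval (fun _ : Fin n => ρ) j)
  have hLs : MemLp (∑ j, fun ca : Fin n → E => h (ca j)) 2 (Measure.pi fun _ => ρ) :=
    memLp_finsetSum' _ fun j _ => hLi j
  have hvar : variance (∑ j, fun ca : Fin n → E => h (ca j)) (Measure.pi fun _ => ρ) ≤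
      n * B ^ 2 := by
    rw [variance_sum_pi (μ := fun _ : Fin n => ρ) (X := fun _ => h) fun _ => hL,
      Finset.sum_const, Finset.card_univ, Fintype.card_fin, nsmul_eq_mul]
    gcongr
    refine (variance_le_sq_of_bounded (ae_of_all _ fun e => abs_le.1 (hB e))
      hm.aemeasurable).trans_eq ?_
    ring
  have hmean : ∫ ca, (∑ j, fun ca : Fin n → E => h (ca j)) ca ∂(Measure.pi fun _ => ρ) =
      n * ∫ e, h e ∂ρ := by
    simp only [Finset.sum_apply]
    rw [integral_finsetSum _ fun j _ => (hLi j).integrable one_le_two]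
    simp_rw [fun j : Fin n => integral_comp_eval (μ := fun _ : Fin n => ρ) (i := j)
      hm.aestronglyMeasurable]
    simp
  refine (measure_mono fun ca hca => ?_).trans
    ((meas_ge_le_variance_div_sq hLs (mul_pos hn' ht)).trans (ENNReal.ofReal_le_ofReal ?_))
  · rw [Set.mem_ofPred_eq, hmean, Finset.sum_apply]
    refine le_trans ?_ (le_abs_self _)
    have : n * (∫ e, h e ∂ρ + t) ≤ ∑ j, h (ca j) := hca
    linarith
  · calc _ ≤ (n * B ^ 2) / (n * t) ^ 2 := by gcongr
      _ = B ^ 2 / (n * t ^ 2) := by field_simp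

open Classical in
/-- A weak law of large numbers, uniform over weight functions with small tails: a set carrying on
average less than a proportion `a` of the weight rarely carries more in a large sample. -/
lemma measure_weight_proportion_le {w : E → ℝ≥0∞} (hw : Measurable w) {S : Set E}
    (hS : MeasurableSet S) {a c B : ℝ} (ha0 : 0 ≤ a) (ha1 : a ≤ 1) (hc : 0 < c) (hB : 0 ≤ B)
    (hn : 0 < n) (hfin : ∫⁻ e, w e ∂ρ < ∞)
    (hmean : ∫⁻ e in S, w e ∂ρ + ENNReal.ofReal c ≤ ENNReal.ofReal a * ∫⁻ e, w e ∂ρ) :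
    (Measure.pi fun _ : Fin n => ρ) {ca | ENNReal.ofReal a * ∑ j, w (ca j) ≤
        ∑ j, if ca j ∈ S then w (ca j) else 0} ≤
      (∫⁻ e in {e | ENNReal.ofReal B < w e}, w e ∂ρ) / ENNReal.ofReal (c / 4) +
        ENNReal.ofReal (B ^ 2 / (n * (c / 2) ^ 2)) := by
  set R : Set E := {e | ENNReal.ofReal B < w e} with hR
  have hRm : MeasurableSet R := measurableSet_lt measurable_const hw
  set T := ∫⁻ e in R, w e ∂ρ with hT
  have hc4 : ENNReal.ofReal (c / 4) ≠ 0 := by simpa using by linarith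
  -- If the tail exceeds `c / 4`, the claimed bound is at least 1.
  rcases lt_or_ge (ENNReal.ofReal (c / 4)) T with hTc | hTc
  · refine prob_le_one.trans (le_trans ?_ le_self_add)
    rw [ENNReal.le_div_iff_mul_le (Or.inl hc4) (Or.inl ENNReal.ofReal_ne_top), one_mul]
    exact hTc.le
  have hn' : (0 : ℝ) < n := Nat.cast_pos.2 hn
  set g : E → ℝ := fun e => (w e).toReal with hg
  have hgm : Measurable g := hw.ennreal_toReal
  have hg0 (e : E) : 0 ≤ g e := ENNReal.toReal_nonneg
  have hgi : Integrable g ρ := integrable_toReal_of_lintegral_ne_top hw.aemeasurable hfin.ne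
  have hint (A : Set E) : ∫ e in A, g e ∂ρ = (∫⁻ e in A, w e ∂ρ).toReal :=
    integral_toReal hw.aemeasurable.restrict (ae_restrict_of_ae (ae_lt_top hw hfin.ne))
  have hfinA (A : Set E) : ∫⁻ e in A, w e ∂ρ ≠ ∞ := ((setLIntegral_le_lintegral A _).trans_lt hfin).ne
  -- Excess weight of `S` over the proportion `a`, truncated to weights at most `B`, so that
  -- Chebyshev applies.
  set h : E → ℝ := Rᶜ.indicator (fun e => g e * (S.indicator 1 e - a)) with hh
  have hhm : Measurable h :=
    (hgm.mul ((measurable_one.indicator hS).sub_const a)).indicator hRm.compl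
  have hfac (e : E) : |S.indicator (1 : E → ℝ) e - a| ≤ 1 := by
    by_cases he : e ∈ S
    · rw [Set.indicator_of_mem he, abs_le]; simp only [Pi.one_apply]; constructor <;> linarith
    · rw [Set.indicator_of_notMem he, abs_le]; constructor <;> linarith
  have hhB (e : E) : |h e| ≤ B := by
    by_cases he : e ∈ R
    · rw [hh, Set.indicator_of_notMem (by simpa using he)]; simpa using hB
    · rw [hh, Set.indicator_of_mem (by simpa using he), abs_mul, abs_of_nonneg (hg0 e)]
      have h1 : g e ≤ B := ENNReal.toReal_le_of_le_ofReal hB (not_lt.1 he)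
      nlinarith [hfac e, hg0 e, abs_nonneg (S.indicator (1 : E → ℝ) e - a)]
  -- The untruncated mean is at most `-c`, and truncation adds back at most `a * (c / 4) ≤ c / 4`.
  have hEh : ∫ e, h e ∂ρ ≤ -(3 * c / 4) := by
    have e1 : h = fun e => (S \ R).indicator g e - a * (g e - R.indicator g e) := by
      funext e
      by_cases heR : e ∈ R <;> by_cases heS : e ∈ S <;> simp [hh, heR, heS, mul_comm]
      ring
    have e2 : ∫ e, h e ∂ρ = ∫ e in S \ R, g e ∂ρ - a * (∫ e, g e ∂ρ - ∫ e in R, g e ∂ρ) := by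
      have hi : Integrable (fun e => a * (g e - R.indicator g e)) ρ :=
        (hgi.sub (hgi.indicator hRm)).const_mul a
      simp only [e1]
      rw [integral_sub (hgi.indicator (hS.diff hRm)) hi, integral_const_mul,
        integral_sub hgi (hgi.indicator hRm), integral_indicator (hS.diff hRm),
        integral_indicator hRm]
    have e3 : ∫ e in S \ R, g e ∂ρ ≤ ∫ e in S, g e ∂ρ :=
      setIntegral_mono_set hgi.integrableOn (ae_of_all _ hg0)
        (LE.le.eventuallyLE Set.sdiff_subset)
    have e4 : ∫ e in S, g e ∂ρ + c ≤ a * ∫ e, g e ∂ρ := by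
      rw [hint S, ← setIntegral_univ, hint Set.univ, setLIntegral_univ, ← ENNReal.toReal_ofReal ha0,
        ← ENNReal.toReal_mul]
      conv_lhs => rw [← ENNReal.toReal_ofReal hc.le]
      rw [← ENNReal.toReal_add (hfinA S) ENNReal.ofReal_ne_top]
      exact ENNReal.toReal_mono (ENNReal.mul_ne_top ENNReal.ofReal_ne_top hfin.ne) hmean
    have e5 : ∫ e in R, g e ∂ρ ≤ c / 4 := by
      rw [hint R]
      exact ENNReal.toReal_le_of_le_ofReal (by linarith) hTc
    have e6 : 0 ≤ ∫ e in R, g e ∂ρ := setIntegral_nonneg hRm fun e _ => hg0 e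
    rw [e2]
    nlinarith
  have hM1 : (Measure.pi fun _ : Fin n => ρ)
      {ca | ENNReal.ofReal (n * (c / 4)) ≤ ∑ j, R.indicator w (ca j)} ≤
        T / ENNReal.ofReal (c / 4) := by
    have hmi : Measurable (R.indicator w) := hw.indicator hRm
    have hmj (j : Fin n) : Measurable fun ca : Fin n → E => R.indicator w (ca j) :=
      hmi.comp (measurable_pi_apply j)
    refine (meas_ge_le_lintegral_div (Finset.measurable_fun_sum _ fun j _ =>
      hmj j).aemeasurable ?_ ENNReal.ofReal_ne_top).trans (le_of_eq ?_)
    · exact (ENNReal.ofReal_pos.2 (by positivity)).ne'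
    · rw [lintegral_finsetSum _ fun j _ => hmj j]
      have hj (j : Fin n) : ∫⁻ ca, R.indicator w (ca j) ∂(Measure.pi fun _ : Fin n => ρ) =
          ∫⁻ e, R.indicator w e ∂ρ :=
        (measurePreserving_eval (fun _ : Fin n => ρ) j).lintegral_comp hmi
      rw [Finset.sum_congr rfl fun j _ => hj j, Finset.sum_const, Finset.card_univ, Fintype.card_fin, nsmul_eq_mul,
        lintegral_indicator hRm, ENNReal.ofReal_mul hn'.le, ENNReal.ofReal_natCast,
        ENNReal.mul_div_mul_left _ _ (by simpa using hn.ne') (ENNReal.natCast_ne_top n)]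
  -- Outside both events the truncated sum is below `n * (-3c/4 + c/2) = -n * c/4` and the tail sum
  -- is below `n * c/4`. Their total is negative, whereas `hca` makes it nonnegative.
  refine (measure_mono fun ca hca => ?_).trans ((measure_union_le _ _).trans
    (add_le_add hM1 (measure_sum_ge_le ρ hhm hhB (t := c / 2) (by linarith) hn)))
  by_contra hcon
  rw [Set.mem_union, not_or] at hcon
  obtain ⟨hc1, hc2⟩ := hcon
  simp only [Set.mem_ofPred_eq, not_le] at hc1 hc2
  -- An infinite weight lies in the tail set and would make the tail sum infinite.
  have hwf (j : Fin n) : w (ca j) ≠ ∞ := by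
    intro hj
    refine absurd hc1 (not_lt.2 (le_trans ?_
      (Finset.single_le_sum (fun _ _ => zero_le) (Finset.mem_univ j))))
    rw [Set.indicator_of_mem (by simp [hR, hj]), hj]
    exact le_top
  have hs0 : a * ∑ j, g (ca j) ≤ ∑ j, S.indicator g (ca j) := by
    have h1 : ENNReal.ofReal a * ∑ j, w (ca j) ≤
        ∑ j, if ca j ∈ S then w (ca j) else 0 := hca
    have h2 := ENNReal.toReal_mono (ENNReal.sum_ne_top.2 fun j _ => by
      split_ifs
      · exact hwf j
      · exact ENNReal.zero_ne_top) h1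
    rw [ENNReal.toReal_mul, ENNReal.toReal_ofReal ha0, ENNReal.toReal_sum fun j _ => hwf j,
      ENNReal.toReal_sum fun j _ => by
        split_ifs
        · exact hwf j
        · exact ENNReal.zero_ne_top] at h2
    refine h2.trans_eq (Finset.sum_congr rfl fun j _ => ?_)
    by_cases hj : ca j ∈ S <;> simp [hj, hg]
  have hs1 : ∑ j, R.indicator g (ca j) < n * (c / 4) := by
    have h2 : (∑ j, R.indicator w (ca j)).toReal < n * (c / 4) :=
      ENNReal.toReal_lt_of_lt_ofReal hc1
    rw [ENNReal.toReal_sum fun j _ => by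
      by_cases hj : ca j ∈ R <;> simp [hj, hwf j]] at h2
    refine lt_of_le_of_lt (le_of_eq (Finset.sum_congr rfl fun j _ => ?_)) h2
    by_cases hj : ca j ∈ R <;> simp [hj, hg]
  have hs2 : ∑ j, S.indicator g (ca j) - a * ∑ j, g (ca j) ≤
      ∑ j, h (ca j) + ∑ j, R.indicator g (ca j) := by
    rw [Finset.mul_sum, ← Finset.sum_sub_distrib, ← Finset.sum_add_distrib]
    refine Finset.sum_le_sum fun j _ => ?_
    have := hg0 (ca j)
    by_cases heR : ca j ∈ R <;> by_cases heS : ca j ∈ S <;> simp [hh, heR, heS] <;> nlinarith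
  have : (n : ℝ) * (∫ e, h e ∂ρ + c / 2) ≤ n * (-(c / 4)) := by
    gcongr
    linarith
  linarith

end Concentration

/-! ### Product measures and densities depending on the covariate only -/

section Product

variable {𝒵 𝒞 𝒳 E : Type*} [MeasurableSpace 𝒵] [MeasurableSpace 𝒞] [MeasurableSpace 𝒳]
  [MeasurableSpace E]

lemma prod_prod_apply {τ : Measure 𝒵} {π : Measure 𝒞} {ν : Measure E} [SFinite τ] [SFinite π]
    [SFinite ν] {S : Set ((𝒵 × 𝒞) × E)} (hS : MeasurableSet S) :
    ((τ.prod π).prod ν) S = ∫⁻ z, (π.prod ν) {q | ((z, q.1), q.2) ∈ S} ∂τ := by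
  rw [Measure.prod_apply hS, lintegral_prod _ (measurable_measure_prodMk_left hS).aemeasurable]
  refine lintegral_congr fun z => ?_
  have hz : MeasurableSet {q : 𝒞 × E | ((z, q.1), q.2) ∈ S} :=
    hS.preimage (f := fun q : 𝒞 × E => ((z, q.1), q.2)) (by fun_prop)
  rw [Measure.prod_apply hz]
  rfl

lemma withDensity_compProd_fst {μ : Measure 𝒳} [SFinite μ] {κ : Kernel 𝒳 E} [IsMarkovKernel κ]
    {f : 𝒳 → ℝ≥0∞} (hf : Measurable f) :
    μ.withDensity f ⊗ₘ κ = (μ ⊗ₘ κ).withDensity fun z => f z.1 := by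
  ext s hs
  have hf' : Measurable fun z : 𝒳 × E => f z.1 := hf.comp measurable_fst
  have hκ : Measurable fun x => κ x (Prod.mk x ⁻¹' s) := Kernel.measurable_kernel_prodMk_left hs
  rw [Measure.compProd_apply hs, lintegral_withDensity_eq_lintegral_mul _ hf hκ,
    withDensity_apply _ hs, ← lintegral_indicator hs,
    Measure.lintegral_compProd (hf'.indicator hs)]
  refine lintegral_congr fun x => ?_
  have h : (fun y => s.indicator (fun z : 𝒳 × E => f z.1) (x, y)) =
      (Prod.mk x ⁻¹' s).indicator fun _ => f x := by
    rfl
  simp only [Pi.mul_apply]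
  rw [h, lintegral_indicator (measurable_prodMk_left hs), setLIntegral_const]

lemma lintegral_compProd_fst {μ : Measure 𝒳} [SFinite μ] {κ : Kernel 𝒳 E} [IsMarkovKernel κ]
    {f : 𝒳 → ℝ≥0∞} (hf : Measurable f) : ∫⁻ z, f z.1 ∂(μ ⊗ₘ κ) = ∫⁻ x, f x ∂μ := by
  have hf' : Measurable fun z : 𝒳 × E => f z.1 := hf.comp measurable_fst
  rw [Measure.lintegral_compProd hf']
  simp

end Product

/-! ### Lower bounds for coverage at finite sample sizes -/

section Coverage

variable {𝒵 𝒳 : Type*} [MeasurableSpace 𝒵] [MeasurableSpace 𝒳]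
  {τ : Measure 𝒵} [IsProbabilityMeasure τ] {μ : Measure 𝒳} [IsProbabilityMeasure μ]
  {κ : Kernel 𝒳 ℝ} [IsMarkovKernel κ] {α : ℝ} {qlo qhi : 𝒵 → 𝒳 → ℝ} {ehat : 𝒵 → 𝒳 → ℝ≥0∞}
  {n : ℕ}

lemma measurable_score (hqlo : Measurable (Function.uncurry qlo))
    (hqhi : Measurable (Function.uncurry qhi)) :
    Measurable fun q : 𝒵 × 𝒳 × ℝ => score (qlo q.1) (qhi q.1) q.2 := by
  have h1 : Measurable fun q : 𝒵 × 𝒳 × ℝ => qlo q.1 q.2.1 :=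
    hqlo.comp (f := fun q : 𝒵 × 𝒳 × ℝ => (q.1, q.2.1)) (by fun_prop)
  have h2 : Measurable fun q : 𝒵 × 𝒳 × ℝ => qhi q.1 q.2.1 :=
    hqhi.comp (f := fun q : 𝒵 × 𝒳 × ℝ => (q.1, q.2.1)) (by fun_prop)
  exact (h1.sub measurable_snd.snd).max (measurable_snd.snd.sub h2)

lemma measurable_inv_fst (h_ehat : Measurable (Function.uncurry ehat)) :
    Measurable fun q : 𝒵 × 𝒳 × ℝ => (ehat q.1 q.2.1)⁻¹ :=
  (h_ehat.comp (f := fun q : 𝒵 × 𝒳 × ℝ => (q.1, q.2.1)) (by fun_prop)).inv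

/-- The loss of coverage due to the estimation of the weights is at most a multiple of their
`L¹` error. -/
lemma le_coverage_add_absDiff (hα : α ∈ Set.Ioo (0 : ℝ) 1)
    (hqlo : Measurable (Function.uncurry qlo)) (hqhi : Measurable (Function.uncurry qhi))
    (h_ehat : Measurable (Function.uncurry ehat))
    (h_int : ∀ᵐ z ∂τ, ∫⁻ x, (ehat z x)⁻¹ ∂μ < ∞)
    {c : ℝ≥0∞} {w₀ : 𝒳 → ℝ≥0∞} (hw₀ : Measurable w₀) (hc : c * ∫⁻ x, w₀ x ∂μ = 1) :
    ENNReal.ofReal (1 - α) ≤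
      coverage τ (μ ⊗ₘ κ) ((μ.withDensity fun x => c * w₀ x) ⊗ₘ κ) α qlo qhi ehat n +
        2 * c * ∫⁻ z, ∫⁻ x, absDiff (ehat z x)⁻¹ (w₀ x) ∂μ ∂τ := by
  have ha : ENNReal.ofReal (1 - α) < 1 := by
    rw [← ENNReal.ofReal_one]
    exact (ENNReal.ofReal_lt_ofReal_iff one_pos).2 (by linarith [hα.1])
  have hinv : Measurable fun q : 𝒵 × 𝒳 => (ehat q.1 q.2)⁻¹ := h_ehat.inv
  have hD : Measurable fun q : 𝒵 × 𝒳 => absDiff (ehat q.1 q.2)⁻¹ (w₀ q.2) :=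
    (hinv.sub (hw₀.comp measurable_snd)).add ((hw₀.comp measurable_snd).sub hinv)
  rw [withDensity_compProd_fst (by fun_prop)]
  set S : Set ((𝒵 × (Fin n → 𝒳 × ℝ)) × 𝒳 × ℝ) := {q | ¬ MostWeightBelow (ENNReal.ofReal (1 - α))
    (fun e => (ehat q.1.1 e.1)⁻¹) (score (qlo q.1.1) (qhi q.1.1)) q.1.2 q.2} with hS
  have hSm : MeasurableSet S :=
    (measurableSet_mostWeightBelow _ (w := fun z (e : 𝒳 × ℝ) => (ehat z e.1)⁻¹)
      (measurable_inv_fst h_ehat) (v := fun z => score (qlo z) (qhi z))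
      (measurable_score hqlo hqhi)).compl
  -- An inclusion suffices: the coverage event contains the measurable set `S`, so its own
  -- measurability is not needed.
  have hcov : ((τ.prod (Measure.pi fun _ : Fin n => μ ⊗ₘ κ)).prod
      ((μ ⊗ₘ κ).withDensity fun z => c * w₀ z.1)) S ≤
      coverage τ (μ ⊗ₘ κ) ((μ ⊗ₘ κ).withDensity fun z => c * w₀ z.1) α qlo qhi ehat n :=
    measure_mono fun q hq => mem_interval_of_score_le_of_not_le le_rfl hq
  refine le_trans ?_ (add_le_add_left hcov _)
  have hDz : Measurable fun z => ∫⁻ x, absDiff (ehat z x)⁻¹ (w₀ x) ∂μ := hD.lintegral_prod_right'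
  rw [prod_prod_apply hSm, ← lintegral_const_mul _ hDz,
    ← lintegral_add_right _ (hDz.const_mul _)]
  calc ENNReal.ofReal (1 - α) = ∫⁻ _z, ENNReal.ofReal (1 - α) ∂τ := by simp
    _ ≤ _ := lintegral_mono_ae ?_
  filter_upwards [h_int] with z hz
  have hez : Measurable fun x => (ehat z x)⁻¹ := hinv.comp measurable_prodMk_left
  have hSz : {q : (Fin n → 𝒳 × ℝ) × 𝒳 × ℝ | ((z, q.1), q.2) ∈ S} =
      {q | ¬ MostWeightBelow (ENNReal.ofReal (1 - α)) (fun e => (ehat z e.1)⁻¹)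
        (score (qlo z) (qhi z)) q.1 q.2} := rfl
  have hDz' : Measurable fun x => absDiff (ehat z x)⁻¹ (w₀ x) :=
    (hez.sub hw₀).add (hw₀.sub hez)
  have h := le_lintegral_not_mostWeightBelow (n := n) (μ ⊗ₘ κ) ha
    (w := fun e => (ehat z e.1)⁻¹) (w₀ := fun e => w₀ e.1) (c := c)
    (v := score (qlo z) (qhi z)) (hez.comp measurable_fst)
    (hw₀.comp measurable_fst) ((measurable_score hqlo hqhi).comp measurable_prodMk_left)
    (by rwa [lintegral_compProd_fst hez]) (by rwa [lintegral_compProd_fst hw₀])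
  rwa [lintegral_compProd_fst hDz'] at h

/-- The calibration scores below `-t` carry a proportion of at least `1 - α` of the weight. -/
def LowScores (α t : ℝ) (qlo qhi : 𝒵 → 𝒳 → ℝ) (ehat : 𝒵 → 𝒳 → ℝ≥0∞) (n : ℕ) :
    Set (𝒵 × (Fin n → 𝒳 × ℝ)) :=
  {q | ENNReal.ofReal (1 - α) * ∑ j, (ehat q.1 (q.2 j).1)⁻¹ ≤
    ∑ j, if score (qlo q.1) (qhi q.1) (q.2 j) < -t then (ehat q.1 (q.2 j).1)⁻¹ else 0}

lemma measurableSet_lowScores {t : ℝ} (hqlo : Measurable (Function.uncurry qlo))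
    (hqhi : Measurable (Function.uncurry qhi)) (h_ehat : Measurable (Function.uncurry ehat)) :
    MeasurableSet (LowScores α t qlo qhi ehat n) := by
  have hw (j : Fin n) : Measurable fun q : 𝒵 × (Fin n → 𝒳 × ℝ) => (ehat q.1 (q.2 j).1)⁻¹ :=
    (measurable_inv_fst h_ehat).comp (f := fun q : 𝒵 × (Fin n → 𝒳 × ℝ) => (q.1, q.2 j))
      (by fun_prop)
  have hv (j : Fin n) : Measurable fun q : 𝒵 × (Fin n → 𝒳 × ℝ) =>
      score (qlo q.1) (qhi q.1) (q.2 j) :=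
    (measurable_score hqlo hqhi).comp (f := fun q : 𝒵 × (Fin n → 𝒳 × ℝ) => (q.1, q.2 j))
      (by fun_prop)
  exact measurableSet_le ((Finset.measurable_fun_sum _ fun j _ => hw j).const_mul _)
    (Finset.measurable_fun_sum _ fun j _ => Measurable.ite
      (measurableSet_lt (hv j) measurable_const) (hw j) measurable_const)

omit [MeasurableSpace 𝒵] [MeasurableSpace 𝒳] in
-- `LowScores` leaves out the weight of the test point and so does not involve `x`. Including that
-- weight only makes the inequality harder, hence one event controls all test covariates.
lemma mem_interval_of_notMem_lowScores {t : ℝ} {z : 𝒵} {ca : Fin n → 𝒳 × ℝ} {x : 𝒳} {y : ℝ}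
    (h : (z, ca) ∉ LowScores α t qlo qhi ehat n) (hs : score (qlo z) (qhi z) (x, y) ≤ -t) :
    y ∈ interval α (qlo z) (qhi z) (fun x => (ehat z x)⁻¹) ca x := by
  refine mem_interval_of_score_le_of_not_le hs fun hle => h (le_trans ?_ hle)
  gcongr
  exact le_self_add

/-- Union bound: a miss requires `LowScores`, a quantile error above `t`, or a small error together
with a score above `-t`. -/
lemma one_le_conditionalCoverage_add {ρ : Measure (𝒳 × ℝ)} [IsProbabilityMeasure ρ]
    (hqlo : Measurable (Function.uncurry qlo)) (hqhi : Measurable (Function.uncurry qhi))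
    {H : 𝒵 → 𝒳 → ℝ} (hH : Measurable (Function.uncurry H)) {t : ℝ} {b : ℝ≥0∞} {x : 𝒳}
    (hb : ∀ z, H z x ≤ t → κ x {y | -t < score (qlo z) (qhi z) (x, y)} ≤ b) :
    1 ≤ conditionalCoverage τ ρ (κ x) α qlo qhi ehat n x +
      (τ.prod (Measure.pi fun _ => ρ)) (LowScores α t qlo qhi ehat n) +
      τ {z | t < H z x} + b := by
  set m := (τ.prod (Measure.pi fun _ : Fin n => ρ)).prod (κ x) with hm
  set C : Set ((𝒵 × (Fin n → 𝒳 × ℝ)) × ℝ) := {p | p.2 ∈ interval α (qlo p.1.1) (qhi p.1.1)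
    (fun x' => (ehat p.1.1 x')⁻¹) p.1.2 x}
  set L := LowScores α t qlo qhi ehat n
  have hHx : Measurable fun z => H z x := hH.comp measurable_prodMk_right
  have hs : Measurable fun q : (𝒵 × (Fin n → 𝒳 × ℝ)) × ℝ =>
      score (qlo q.1.1) (qhi q.1.1) (x, q.2) :=
    (measurable_score hqlo hqhi).comp
      (f := fun q : (𝒵 × (Fin n → 𝒳 × ℝ)) × ℝ => (q.1.1, x, q.2)) (by fun_prop)
  have hcover : (Set.univ : Set ((𝒵 × (Fin n → 𝒳 × ℝ)) × ℝ)) ⊆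
      C ∪ Prod.fst ⁻¹' L ∪ (fun q => q.1.1) ⁻¹' {z | t < H z x} ∪
        {q | H q.1.1 x ≤ t ∧ -t < score (qlo q.1.1) (qhi q.1.1) (x, q.2)} := by
    rintro ⟨⟨z, ca⟩, y⟩ -
    by_cases h1 : (z, ca) ∈ L
    · exact Or.inl (Or.inl (Or.inr h1))
    by_cases h2 : t < H z x
    · exact Or.inl (Or.inr h2)
    by_cases h3 : score (qlo z) (qhi z) (x, y) ≤ -t
    · exact Or.inl (Or.inl (Or.inl (mem_interval_of_notMem_lowScores h1 h3)))
    · exact Or.inr ⟨not_lt.1 h2, not_le.1 h3⟩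
  have h2 : m (Prod.fst ⁻¹' L) ≤ (τ.prod (Measure.pi fun _ => ρ)) L := by
    rw [← Set.prod_univ, hm, Measure.prod_prod, measure_univ, mul_one]
  have h3 : m ((fun q => q.1.1) ⁻¹' {z | t < H z x}) = τ {z | t < H z x} :=
    (measurePreserving_fst.comp measurePreserving_fst).measure_preimage
      (measurableSet_lt measurable_const hHx).nullMeasurableSet
  have h4 : m {q | H q.1.1 x ≤ t ∧ -t < score (qlo q.1.1) (qhi q.1.1) (x, q.2)} ≤ b := by
    have hS : MeasurableSet {q : (𝒵 × (Fin n → 𝒳 × ℝ)) × ℝ |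
        H q.1.1 x ≤ t ∧ -t < score (qlo q.1.1) (qhi q.1.1) (x, q.2)} :=
      (measurableSet_le (hHx.comp measurable_fst.fst) measurable_const).inter
        (measurableSet_lt measurable_const hs)
    rw [hm, Measure.prod_apply hS]
    refine (lintegral_mono fun q => ?_).trans_eq (by rw [lintegral_const, measure_univ, mul_one])
    by_cases hq : H q.1 x ≤ t
    · exact (measure_mono fun y hy => hy.2).trans (hb q.1 hq)
    · refine le_trans (le_of_eq ?_) zero_le
      convert measure_empty (μ := κ x)
      exact Set.eq_empty_of_forall_notMem fun y hy => hq hy.1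
  calc (1 : ℝ≥0∞) = m Set.univ := by rw [measure_univ]
    _ ≤ m C + m (Prod.fst ⁻¹' L) + m ((fun q => q.1.1) ⁻¹' {z | t < H z x}) +
        m {q | H q.1.1 x ≤ t ∧ -t < score (qlo q.1.1) (qhi q.1.1) (x, q.2)} := by
      refine (measure_mono hcover).trans ((measure_union_le _ _).trans ?_)
      gcongr
      refine (measure_union_le _ _).trans ?_
      gcongr
      exact measure_union_le _ _
    _ ≤ _ := by
      gcongr
      · exact le_rfl
      · exact h3.le

/-- The same union bound with a random covariate; the score condition is needed only almost
everywhere. -/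
lemma one_le_coverage_add {ρ : Measure (𝒳 × ℝ)} [IsProbabilityMeasure ρ]
    {π : Measure 𝒳} [IsProbabilityMeasure π]
    (hqlo : Measurable (Function.uncurry qlo)) (hqhi : Measurable (Function.uncurry qhi))
    {H : 𝒵 → 𝒳 → ℝ} (hH : Measurable (Function.uncurry H)) {t : ℝ} {b : ℝ≥0∞}
    (hb : ∀ᵐ x ∂π, ∀ z, H z x ≤ t → κ x {y | -t < score (qlo z) (qhi z) (x, y)} ≤ b) :
    1 ≤ coverage τ ρ (π ⊗ₘ κ) α qlo qhi ehat n +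
      (τ.prod (Measure.pi fun _ => ρ)) (LowScores α t qlo qhi ehat n) +
      (τ.prod π) {q | t < H q.1 q.2} + b := by
  set m := (τ.prod (Measure.pi fun _ : Fin n => ρ)).prod (π ⊗ₘ κ) with hm
  set C : Set ((𝒵 × (Fin n → 𝒳 × ℝ)) × 𝒳 × ℝ) := {p | p.2.2 ∈ interval α (qlo p.1.1) (qhi p.1.1)
    (fun x' => (ehat p.1.1 x')⁻¹) p.1.2 p.2.1}
  set L := LowScores α t qlo qhi ehat n
  have hH' : Measurable fun q : (𝒵 × (Fin n → 𝒳 × ℝ)) × 𝒳 × ℝ => H q.1.1 q.2.1 :=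
    hH.comp (f := fun q : (𝒵 × (Fin n → 𝒳 × ℝ)) × 𝒳 × ℝ => (q.1.1, q.2.1)) (by fun_prop)
  have hs : Measurable fun q : (𝒵 × (Fin n → 𝒳 × ℝ)) × 𝒳 × ℝ =>
      score (qlo q.1.1) (qhi q.1.1) q.2 :=
    (measurable_score hqlo hqhi).comp
      (f := fun q : (𝒵 × (Fin n → 𝒳 × ℝ)) × 𝒳 × ℝ => (q.1.1, q.2)) (by fun_prop)
  have hcover : (Set.univ : Set ((𝒵 × (Fin n → 𝒳 × ℝ)) × 𝒳 × ℝ)) ⊆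
      C ∪ Prod.fst ⁻¹' L ∪ (Prod.map Prod.fst Prod.fst) ⁻¹' {q : 𝒵 × 𝒳 | t < H q.1 q.2} ∪
        {q | H q.1.1 q.2.1 ≤ t ∧ -t < score (qlo q.1.1) (qhi q.1.1) q.2} := by
    rintro ⟨⟨z, ca⟩, x, y⟩ -
    by_cases h1 : (z, ca) ∈ L
    · exact Or.inl (Or.inl (Or.inr h1))
    by_cases h2 : t < H z x
    · exact Or.inl (Or.inr h2)
    by_cases h3 : score (qlo z) (qhi z) (x, y) ≤ -t
    · exact Or.inl (Or.inl (Or.inl (mem_interval_of_notMem_lowScores h1 h3)))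
    · exact Or.inr ⟨not_lt.1 h2, not_le.1 h3⟩
  have h2 : m (Prod.fst ⁻¹' L) ≤ (τ.prod (Measure.pi fun _ => ρ)) L := by
    rw [← Set.prod_univ, hm, Measure.prod_prod, measure_univ, mul_one]
  have h3 : m ((Prod.map Prod.fst Prod.fst) ⁻¹' {q : 𝒵 × 𝒳 | t < H q.1 q.2}) =
      (τ.prod π) {q | t < H q.1 q.2} := by
    have hfst : MeasurePreserving Prod.fst (π ⊗ₘ κ) π :=
      ⟨measurable_fst, Measure.fst_compProd π κ⟩
    exact (measurePreserving_fst.prod hfst).measure_preimage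
      (measurableSet_lt measurable_const hH).nullMeasurableSet
  have h4 : m {q | H q.1.1 q.2.1 ≤ t ∧ -t < score (qlo q.1.1) (qhi q.1.1) q.2} ≤ b := by
    have hS : MeasurableSet {q : (𝒵 × (Fin n → 𝒳 × ℝ)) × 𝒳 × ℝ |
        H q.1.1 q.2.1 ≤ t ∧ -t < score (qlo q.1.1) (qhi q.1.1) q.2} :=
      (measurableSet_le hH' measurable_const).inter (measurableSet_lt measurable_const hs)
    rw [hm, Measure.prod_apply hS]
    refine (lintegral_mono fun q => ?_).trans_eq (by rw [lintegral_const, measure_univ, mul_one])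
    rw [Measure.compProd_apply (measurable_prodMk_left hS)]
    refine (lintegral_mono_ae ?_).trans_eq
      (by rw [lintegral_const, measure_univ, mul_one] : ∫⁻ _, b ∂π = b)
    filter_upwards [hb] with x hx
    by_cases hq : H q.1 x ≤ t
    · exact (measure_mono fun y hy => hy.2).trans (hx q.1 hq)
    · refine le_trans (le_of_eq ?_) zero_le
      convert measure_empty (μ := κ x)
      exact Set.eq_empty_of_forall_notMem fun y hy => hq hy.1
  calc (1 : ℝ≥0∞) = m Set.univ := by rw [measure_univ]
    _ ≤ m C + m (Prod.fst ⁻¹' L) +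
        m ((Prod.map Prod.fst Prod.fst) ⁻¹' {q : 𝒵 × 𝒳 | t < H q.1 q.2}) +
        m {q | H q.1.1 q.2.1 ≤ t ∧ -t < score (qlo q.1.1) (qhi q.1.1) q.2} := by
      refine (measure_mono hcover).trans ((measure_union_le _ _).trans ?_)
      gcongr
      refine (measure_union_le _ _).trans ?_
      gcongr
      exact measure_union_le _ _
    _ ≤ _ := by
      gcongr
      · exact le_rfl
      · exact h3.le

end Coverage

/-! ### Low scores rarely carry most of the weight -/

section LowScores

variable {𝒵 𝒳 : Type*} [MeasurableSpace 𝒵] [MeasurableSpace 𝒳]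
  {τ : Measure 𝒵} [IsProbabilityMeasure τ] {μ : Measure 𝒳} [IsProbabilityMeasure μ]
  {κ : Kernel 𝒳 ℝ} [IsMarkovKernel κ] {α : ℝ} {n : ℕ}

/-- Where `w > B`, one has `w * B ^ δ ≤ w ^ (1 + δ)`. -/
lemma setLIntegral_le_rpow_div {E : Type*} [MeasurableSpace E] {ν : Measure E} {w : E → ℝ≥0∞}
    (hw : Measurable w) {B δ : ℝ} (hB : 0 < B) (hδ : 0 < δ) :
    ∫⁻ e in {e | ENNReal.ofReal B < w e}, w e ∂ν ≤
      (∫⁻ e, w e ^ (1 + δ) ∂ν) / ENNReal.ofReal B ^ δ := by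
  have hB' : ENNReal.ofReal B ^ δ ≠ 0 :=
    (ENNReal.rpow_pos (ENNReal.ofReal_pos.2 hB) ENNReal.ofReal_ne_top).ne'
  have hB'' : ENNReal.ofReal B ^ δ ≠ ∞ := ENNReal.rpow_ne_top_of_nonneg hδ.le ENNReal.ofReal_ne_top
  rw [ENNReal.le_div_iff_mul_le (Or.inl hB') (Or.inl hB''), ← lintegral_mul_const _ hw]
  refine (setLIntegral_mono' (measurableSet_lt measurable_const hw) fun e he => ?_).trans
    (setLIntegral_le_lintegral _ _)
  rw [ENNReal.rpow_add_of_nonneg _ _ zero_le_one hδ.le, ENNReal.rpow_one]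
  gcongr
  exact le_of_lt he

/-- For a fixed training fold: the calibration scores below `-t` rarely carry a proportion of
`1 - α` of the weight. -/
lemma measure_lowScores_section_le (hα : α ∈ Set.Ioo (0 : ℝ) 1) {qlo qhi : 𝒳 → ℝ}
    (hqlo : Measurable qlo) (hqhi : Measurable qhi) {ehat : 𝒳 → ℝ≥0∞} (h_ehat : Measurable ehat)
    (h_le : ∀ x, ehat x ≤ 1) (h_int : ∫⁻ x, (ehat x)⁻¹ ∂μ < ∞) {H : 𝒳 → ℝ} (hH : Measurable H)
    {t c B δ : ℝ} (ht : 0 < t) (hc : 0 < c) (hcα : c ≤ 1 - α) (hB : 0 < B) (hδ : 0 < δ)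
    (hlow : ∀ᵐ x ∂μ, H x ≤ t / 2 →
      κ x {y | score qlo qhi (x, y) < -t} + ENNReal.ofReal c ≤ ENNReal.ofReal (1 - α))
    (hn : 0 < n) :
    (Measure.pi fun _ : Fin n => μ ⊗ₘ κ)
        {ca | ENNReal.ofReal (1 - α) * ∑ j, (ehat (ca j).1)⁻¹ ≤
          ∑ j, if score qlo qhi (ca j) < -t then (ehat (ca j).1)⁻¹ else 0} ≤
      (∫⁻ x, ENNReal.ofReal (H x) / ehat x ∂μ) / ENNReal.ofReal (t / 2) / ENNReal.ofReal (c / 2) +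
        (∫⁻ x, (ehat x)⁻¹ ^ (1 + δ) ∂μ) / ENNReal.ofReal B ^ δ / ENNReal.ofReal (c / 8) +
        ENNReal.ofReal (B ^ 2 / (n * (c / 4) ^ 2)) := by
  classical
  set A := (∫⁻ x, ENNReal.ofReal (H x) / ehat x ∂μ) / ENNReal.ofReal (t / 2) with hA
  have hc2 : ENNReal.ofReal (c / 2) ≠ 0 := (ENNReal.ofReal_pos.2 (by linarith)).ne'
  have ht2 : ENNReal.ofReal (t / 2) ≠ 0 := (ENNReal.ofReal_pos.2 (by linarith)).ne'
  rcases lt_or_ge (ENNReal.ofReal (c / 2)) A with hAc | hAc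
  · refine prob_le_one.trans (le_trans ?_ (le_self_add.trans le_self_add))
    rw [ENNReal.le_div_iff_mul_le (Or.inl hc2) (Or.inl ENNReal.ofReal_ne_top), one_mul]
    exact hAc.le
  have hw : Measurable fun x => (ehat x)⁻¹ := h_ehat.inv
  have hwe : Measurable fun e : 𝒳 × ℝ => (ehat e.1)⁻¹ := hw.comp measurable_fst
  set S : Set (𝒳 × ℝ) := {e | score qlo qhi e < -t} with hS
  have hSm : MeasurableSet S := by
    refine measurableSet_lt ?_ measurable_const
    exact ((hqlo.comp measurable_fst).sub measurable_snd).max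
      (measurable_snd.sub (hqhi.comp measurable_fst))
  set W := ∫⁻ x, (ehat x)⁻¹ ∂μ with hW
  -- As `ê ≤ 1`, weights are at least 1; a gain of `c` in proportion is therefore a gain of at least
  -- `c` in weight.
  have hW1 : 1 ≤ W := by
    calc (1 : ℝ≥0∞) = ∫⁻ _x, 1 ∂μ := by simp
      _ ≤ W := lintegral_mono fun x => ENNReal.one_le_inv.2 (h_le x)
  have hSint : ∫⁻ e in S, (ehat e.1)⁻¹ ∂(μ ⊗ₘ κ) =
      ∫⁻ x, (ehat x)⁻¹ * κ x {y | score qlo qhi (x, y) < -t} ∂μ := by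
    rw [← lintegral_indicator hSm, Measure.lintegral_compProd (hwe.indicator hSm)]
    refine lintegral_congr fun x => ?_
    have h : (fun y => S.indicator (fun e : 𝒳 × ℝ => (ehat e.1)⁻¹) (x, y)) =
        (Prod.mk x ⁻¹' S).indicator fun _ => (ehat x)⁻¹ := rfl
    rw [h, lintegral_indicator (measurable_prodMk_left hSm), setLIntegral_const]
    rfl
  have hκm : Measurable fun x => κ x {y | score qlo qhi (x, y) < -t} :=
    Kernel.measurable_kernel_prodMk_left hSm
  -- Pointwise in `x`: if `H x ≤ t / 2`, use `hlow`; otherwise `1 ≤ H x / (t / 2)`, and the whole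
  -- weight is charged to `A`. Since `A ≤ c / 2`, half of the margin `c` remains in `h2`.
  have h1 : ∫⁻ e in S, (ehat e.1)⁻¹ ∂(μ ⊗ₘ κ) + ENNReal.ofReal c * W ≤
      ENNReal.ofReal (1 - α) * W + A := by
    have hm : Measurable fun x => (ehat x)⁻¹ * κ x {y | score qlo qhi (x, y) < -t} := hw.mul hκm
    rw [hSint, hW, hA, ← lintegral_const_mul _ hw, ← lintegral_const_mul _ hw,
      ← lintegral_add_left hm, ENNReal.div_eq_inv_mul,
      ← lintegral_const_mul _ (by fun_prop), ← lintegral_add_left (by fun_prop)]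
    refine lintegral_mono_ae ?_
    filter_upwards [hlow] with x hx
    rcases le_or_gt (H x) (t / 2) with hHx | hHx
    · calc _ = (ehat x)⁻¹ * (κ x {y | score qlo qhi (x, y) < -t} + ENNReal.ofReal c) := by ring
        _ ≤ (ehat x)⁻¹ * ENNReal.ofReal (1 - α) := by gcongr; exact hx hHx
        _ ≤ _ := by rw [mul_comm]; exact le_self_add
    · calc _ ≤ (ehat x)⁻¹ * 1 + ENNReal.ofReal (1 - α) * (ehat x)⁻¹ := by
            gcongr
            exact prob_le_one
        _ ≤ (ehat x)⁻¹ * ((ENNReal.ofReal (t / 2))⁻¹ * ENNReal.ofReal (H x)) +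
            ENNReal.ofReal (1 - α) * (ehat x)⁻¹ := by
            gcongr
            rw [mul_comm, ← div_eq_mul_inv,
              ENNReal.le_div_iff_mul_le (Or.inl ht2) (Or.inl ENNReal.ofReal_ne_top), one_mul]
            exact ENNReal.ofReal_le_ofReal hHx.le
        _ = _ := by rw [div_eq_mul_inv (ENNReal.ofReal (H x))]; ring
  have h2 : ∫⁻ e in S, (ehat e.1)⁻¹ ∂(μ ⊗ₘ κ) + ENNReal.ofReal (c / 2) ≤
      ENNReal.ofReal (1 - α) * ∫⁻ e : 𝒳 × ℝ, (ehat e.1)⁻¹ ∂(μ ⊗ₘ κ) := by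
    rw [lintegral_compProd_fst hw]
    refine ENNReal.le_of_add_le_add_right (ENNReal.ofReal_ne_top (r := c / 2)) ?_
    rw [add_assoc, ← ENNReal.ofReal_add (by linarith) (by linarith), add_halves]
    calc _ ≤ ∫⁻ e in S, (ehat e.1)⁻¹ ∂(μ ⊗ₘ κ) + ENNReal.ofReal c * W := by
          gcongr
          exact le_mul_of_one_le_right zero_le hW1
      _ ≤ _ := h1.trans (by gcongr)
  have h3 := measure_weight_proportion_le (n := n) (μ ⊗ₘ κ) hwe hSm (a := 1 - α) (c := c / 2)
    (B := B) (by linarith [hα.2]) (by linarith [hα.1]) (by linarith) hB.le hn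
    (by rwa [lintegral_compProd_fst hw]) h2
  have h4 : ∫⁻ e in {e : 𝒳 × ℝ | ENNReal.ofReal B < (ehat e.1)⁻¹}, (ehat e.1)⁻¹ ∂(μ ⊗ₘ κ) ≤
      (∫⁻ x, (ehat x)⁻¹ ^ (1 + δ) ∂μ) / ENNReal.ofReal B ^ δ := by
    rw [← lintegral_compProd_fst (κ := κ) (hw.pow_const (1 + δ))]
    exact setLIntegral_le_rpow_div hwe hB hδ
  rw [show c / 2 / 4 = c / 8 by ring, show c / 2 / 2 = c / 4 by ring] at h3
  calc _ ≤ _ := h3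
    _ ≤ (∫⁻ x, (ehat x)⁻¹ ^ (1 + δ) ∂μ) / ENNReal.ofReal B ^ δ / ENNReal.ofReal (c / 8) +
        ENNReal.ofReal (B ^ 2 / (n * (c / 4) ^ 2)) := by gcongr
    _ ≤ _ := add_le_add_left le_add_self _

lemma measure_lowScores_le (hα : α ∈ Set.Ioo (0 : ℝ) 1) {qlo qhi : 𝒵 → 𝒳 → ℝ}
    {ehat : 𝒵 → 𝒳 → ℝ≥0∞}
    (hqlo : Measurable (Function.uncurry qlo)) (hqhi : Measurable (Function.uncurry qhi))
    (h_ehat : Measurable (Function.uncurry ehat)) (h_le : ∀ z x, ehat z x ≤ 1)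
    (h_int : ∀ᵐ z ∂τ, ∫⁻ x, (ehat z x)⁻¹ ∂μ < ∞)
    {H : 𝒵 → 𝒳 → ℝ} (hH : Measurable (Function.uncurry H))
    {t c B δ : ℝ} (ht : 0 < t) (hc : 0 < c) (hcα : c ≤ 1 - α) (hB : 0 < B) (hδ : 0 < δ)
    (hlow : ∀ᵐ x ∂μ, ∀ z, H z x ≤ t / 2 →
      κ x {y | score (qlo z) (qhi z) (x, y) < -t} + ENNReal.ofReal c ≤ ENNReal.ofReal (1 - α))
    (hn : 0 < n) :
    (τ.prod (Measure.pi fun _ : Fin n => μ ⊗ₘ κ)) (LowScores α t qlo qhi ehat n) ≤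
      (∫⁻ z, ∫⁻ x, ENNReal.ofReal (H z x) / ehat z x ∂μ ∂τ) / ENNReal.ofReal (t / 2) /
          ENNReal.ofReal (c / 2) +
        (∫⁻ z, ∫⁻ x, (ehat z x)⁻¹ ^ (1 + δ) ∂μ ∂τ) / ENNReal.ofReal B ^ δ /
          ENNReal.ofReal (c / 8) +
        ENNReal.ofReal (B ^ 2 / (n * (c / 4) ^ 2)) := by
  have hA : Measurable fun z => ∫⁻ x, ENNReal.ofReal (H z x) / ehat z x ∂μ :=
    Measurable.lintegral_prod_right' (f := fun q : 𝒵 × 𝒳 => ENNReal.ofReal (H q.1 q.2) / ehat q.1 q.2)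
      (hH.ennreal_ofReal.div h_ehat)
  have hM : Measurable fun z => ∫⁻ x, (ehat z x)⁻¹ ^ (1 + δ) ∂μ :=
    Measurable.lintegral_prod_right' (f := fun q : 𝒵 × 𝒳 => (ehat q.1 q.2)⁻¹ ^ (1 + δ))
      (h_ehat.inv.pow_const _)
  rw [Measure.prod_apply (measurableSet_lowScores hqlo hqhi h_ehat)]
  have hlow' : ∀ z, ∀ᵐ x ∂μ, H z x ≤ t / 2 →
      κ x {y | score (qlo z) (qhi z) (x, y) < -t} + ENNReal.ofReal c ≤ ENNReal.ofReal (1 - α) :=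
    fun z => hlow.mono fun x hx => hx z
  have hsplit {f g : 𝒵 → ℝ≥0∞} (hf : Measurable f) (hg : Measurable g) (k₁ k₂ k₃ k₄ C : ℝ≥0∞) :
      ∫⁻ z, (f z / k₁ / k₂ + g z / k₃ / k₄ + C) ∂τ =
        (∫⁻ z, f z ∂τ) / k₁ / k₂ + (∫⁻ z, g z ∂τ) / k₃ / k₄ + C := by
    simp only [div_eq_mul_inv]
    rw [lintegral_add_right _ measurable_const, lintegral_add_left (by fun_prop),
      lintegral_mul_const _ (by fun_prop), lintegral_mul_const _ hf,
      lintegral_mul_const _ (by fun_prop), lintegral_mul_const _ hg, lintegral_const,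
      measure_univ, mul_one]
  refine (lintegral_mono_ae (h_int.mono fun z hz => measure_lowScores_section_le (n := n) hα
    (qlo := qlo z) (qhi := qhi z) (ehat := ehat z) (hqlo.comp measurable_prodMk_left) (hqhi.comp measurable_prodMk_left)
    (h_ehat.comp measurable_prodMk_left) (h_le z) hz (H := H z) (hH.comp measurable_prodMk_left)
    ht hc hcα hB hδ (hlow' z) hn)).trans_eq (hsplit hA hM _ _ _ _ _)

end LowScores

/-! ### Joint limits in the two sample sizes -/

section Limits

/-- The bound on `limsup m` allows the truncation level `B` to be fixed first, independently of `N`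
and `n`. The two remaining terms depend on one index each, so the limit is joint. -/
lemma tendsto_zero_of_le_add_tail {L : ℕ → ℕ → ℝ≥0∞} {k₁ k₂ k₃ : ℝ≥0∞} {c δ : ℝ}
    (hk₁ : k₁ ≠ 0) (hk₂ : k₂ ≠ 0) (hk₃ : k₃ ≠ 0) (hc : 0 < c) (hδ : 0 < δ) {a m : ℕ → ℝ≥0∞}
    (ha : Tendsto a atTop (𝓝 0)) (hm : limsup m atTop < ∞)
    (h : ∀ N n, 0 < n → ∀ B : ℝ, 0 < B → L N n ≤ a N / k₁ / k₂ +
      m N / ENNReal.ofReal B ^ δ / k₃ + ENNReal.ofReal (B ^ 2 / (n * c ^ 2))) :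
    Tendsto (fun Nn : ℕ × ℕ => L Nn.1 Nn.2) atTop (𝓝 0) := by
  obtain ⟨K, hmK, hK⟩ := exists_between hm
  have hmK' : ∀ᶠ N in atTop, m N ≤ K := (eventually_lt_of_limsup_lt hmK).mono fun _ h => h.le
  rw [ENNReal.tendsto_nhds_zero]
  intro ε hε
  have hε3 : 0 < ε / 3 := ENNReal.div_pos hε.ne' (by norm_num)
  have hBt : Tendsto (fun B : ℝ => K / ENNReal.ofReal B ^ δ / k₃) atTop (𝓝 0) := by
    have h1 : Tendsto (fun B : ℝ => ENNReal.ofReal B ^ δ) atTop (𝓝 ∞) :=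
      (ENNReal.tendsto_rpow_at_top hδ).comp ENNReal.tendsto_ofReal_atTop
    have h2 := ENNReal.Tendsto.const_div (a := K) h1 (Or.inr hK.ne)
    have h3 := ENNReal.Tendsto.div_const h2 (b := k₃) (Or.inr hk₃)
    simpa using h3
  obtain ⟨B, hB, hB0⟩ := ((hBt.eventually_le_const hε3).and (eventually_gt_atTop 0)).exists
  have haN : Tendsto (fun N => a N / k₁ / k₂) atTop (𝓝 0) := by
    have h2 := ENNReal.Tendsto.div_const ha (b := k₁) (Or.inr hk₁)
    have h3 := ENNReal.Tendsto.div_const h2 (b := k₂) (Or.inr hk₂)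
    simpa using h3
  have hnN : Tendsto (fun n : ℕ => ENNReal.ofReal (B ^ 2 / (n * c ^ 2))) atTop (𝓝 0) := by
    rw [← ENNReal.ofReal_zero]
    refine ENNReal.tendsto_ofReal (Tendsto.const_div_atTop ?_ _)
    exact tendsto_natCast_atTop_atTop.atTop_mul_const (by positivity)
  rw [← prod_atTop_atTop_eq]
  have e1 := tendsto_fst (f := (atTop : Filter ℕ)) (g := (atTop : Filter ℕ))
  have e2 := tendsto_snd (f := (atTop : Filter ℕ)) (g := (atTop : Filter ℕ))
  filter_upwards [e1.eventually hmK', e1.eventually (haN.eventually_le_const hε3),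
    e2.eventually (hnN.eventually_le_const hε3), e2.eventually (eventually_gt_atTop 0)]
    with Nn h1 h2 h3 h4
  calc L Nn.1 Nn.2 ≤ _ := h Nn.1 Nn.2 h4 B hB0
    _ ≤ ε / 3 + ε / 3 + ε / 3 := by
      refine add_le_add (add_le_add h2 (le_trans ?_ hB)) h3
      gcongr
    _ = ε := ENNReal.add_thirds ε

lemma le_liminf_of_le_add_tendsto {ι : Type*} {l : Filter ι} {u v : ι → ℝ≥0∞} {a : ℝ≥0∞}
    (h : ∀ᶠ i in l, a ≤ u i + v i) (hv : Tendsto v l (𝓝 0)) : a ≤ liminf u l := by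
  refine ENNReal.le_of_forall_pos_le_add fun ε hε _ => ?_
  rw [← tsub_le_iff_right]
  refine le_liminf_of_le (by isBoundedDefault) ?_
  filter_upwards [h, hv.eventually_le_const (ENNReal.coe_pos.2 hε)] with i h1 h2
  rw [tsub_le_iff_right]
  exact h1.trans (by gcongr)

end Limits

/-! ### Conditional probabilities of score events -/

section DensityBounds

variable {μ : Measure ℝ} [IsProbabilityMeasure μ] {αlo αhi r b₁ b₂ t : ℝ} {𝒳 : Type*}
  {qlo qhi : 𝒳 → ℝ} {x : 𝒳}

/-- The score threshold shifts each end by `t`, and the estimation error by at most another `t`. Two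
strips of width `2 * t` and density at most `b₂` give `4 * b₂ * t`. -/
lemma measure_lt_score_le (hlo : αlo ∈ Set.Ioo (0 : ℝ) 1) (hhi : αhi ∈ Set.Ioo (0 : ℝ) 1)
    (hb₂ : 0 < b₂) (ht : 0 < t) (htr : 2 * t ≤ r)
    (hd : HasDensityIn μ (Set.Icc (quantile αlo μ - r) (quantile αlo μ + r) ∪
      Set.Icc (quantile αhi μ - r) (quantile αhi μ + r)) b₁ b₂)
    (hH : max |qlo x - quantile αlo μ| |qhi x - quantile αhi μ| ≤ t) :
    μ {y | -t < score qlo qhi (x, y)} ≤ ENNReal.ofReal (1 - (αhi - αlo) + 4 * b₂ * t) := by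
  obtain ⟨h1, h2⟩ := max_le_iff.1 hH
  rw [abs_le] at h1 h2
  have hsub : {y | -t < score qlo qhi (x, y)} ⊆
      Set.Iio (quantile αlo μ + 2 * t) ∪ Set.Ioi (quantile αhi μ - 2 * t) := by
    intro y hy
    rcases lt_max_iff.1 (show -t < max (qlo x - y) (y - qhi x) from hy) with h | h
    · exact Or.inl (show y < _ by linarith)
    · exact Or.inr (show _ < y by linarith)
  have hl := measure_Iio_quantile_add_le hlo (s := 2 * t) (by linarith) hb₂ hd
    ((Set.Icc_subset_Icc (by linarith) (by linarith)).trans Set.subset_union_left)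
  have hh := measure_Ioi_quantile_sub_le hhi (s := 2 * t) (by linarith) hb₂ hd
    ((Set.Icc_subset_Icc (by linarith) (by linarith)).trans Set.subset_union_right)
  refine (measure_mono hsub).trans ((measure_union_le _ _).trans ((add_le_add hl hh).trans_eq ?_))
  have hbt : 0 < b₂ * (2 * t) := by positivity
  rw [← ENNReal.ofReal_add (by linarith [hlo.1]) (by linarith [hhi.2])]
  congr 1
  ring

/-- The threshold moves each end inwards by `t` and the error gives back at most `t / 2`. The strip
gained at the lower end already yields a strict loss of mass. -/
lemma measure_score_lt_add_le (hlo : αlo ∈ Set.Ioo (0 : ℝ) 1) (hhi : αhi ∈ Set.Ioo (0 : ℝ) 1)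
    (hb₁ : 0 < b₁) (ht : 0 < t) (htr : t ≤ r)
    (hd : HasDensityIn μ (Set.Icc (quantile αlo μ - r) (quantile αlo μ + r) ∪
      Set.Icc (quantile αhi μ - r) (quantile αhi μ + r)) b₁ b₂)
    (hH : max |qlo x - quantile αlo μ| |qhi x - quantile αhi μ| ≤ t / 2) :
    μ {y | score qlo qhi (x, y) < -t} + ENNReal.ofReal (min (b₁ * (t / 2)) (αhi - αlo)) ≤
      ENNReal.ofReal (αhi - αlo) := by
  obtain ⟨h1, h2⟩ := max_le_iff.1 hH
  rw [abs_le] at h1 h2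
  have hsub : {y | score qlo qhi (x, y) < -t} ⊆
      Set.Ioo (quantile αlo μ + t / 2) (quantile αhi μ) := by
    intro y hy
    obtain ⟨h3, h4⟩ := max_lt_iff.1 (show max (qlo x - y) (y - qhi x) < -t from hy)
    exact ⟨by linarith, by linarith⟩
  refine (add_le_add_left (measure_mono hsub) _).trans
    (measure_Ioo_quantile_add_le hlo hhi (by linarith) hb₁ hd
      ((Set.Icc_subset_Icc (by linarith) (by linarith)).trans Set.subset_union_left))

end DensityBounds

/-! ### Consequences of the quantile condition -/

section Assembly

/-- Markov's inequality for `H` after the change of measure, which turns the mean of `H` into `c`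
times that of `H / e`. -/
lemma measure_lt_prod_withDensity_le {𝒵 𝒳 : Type*} [MeasurableSpace 𝒵] [MeasurableSpace 𝒳]
    {τ : Measure 𝒵} [SFinite τ] {μ : Measure 𝒳} [SFinite μ] {c : ℝ≥0∞} {e : 𝒳 → ℝ≥0∞}
    (he : Measurable e) {H : 𝒵 → 𝒳 → ℝ} (hH : Measurable (Function.uncurry H)) {t : ℝ}
    (ht : 0 < t) :
    (τ.prod (μ.withDensity fun x => c * (e x)⁻¹)) {q | t < H q.1 q.2} ≤
      c * (∫⁻ z, ∫⁻ x, ENNReal.ofReal (H z x) / e x ∂μ ∂τ) / ENNReal.ofReal t := by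
  have hH' : Measurable fun q : 𝒵 × 𝒳 => ENNReal.ofReal (H q.1 q.2) := hH.ennreal_ofReal
  have hq : Measurable fun q : 𝒵 × 𝒳 => ENNReal.ofReal (H q.1 q.2) / e q.2 :=
    hH'.div (he.comp measurable_snd)
  have hqz (z : 𝒵) : Measurable fun x => ENNReal.ofReal (H z x) / e x :=
    hq.comp measurable_prodMk_left
  have hHz (z : 𝒵) : Measurable fun x => ENNReal.ofReal (H z x) := hH'.comp measurable_prodMk_left
  calc _ ≤ (τ.prod (μ.withDensity fun x => c * (e x)⁻¹))
        {q | ENNReal.ofReal t ≤ ENNReal.ofReal (H q.1 q.2)} :=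
        measure_mono fun q hq => ENNReal.ofReal_le_ofReal (le_of_lt hq)
    _ ≤ _ := meas_ge_le_lintegral_div hH'.aemeasurable (ENNReal.ofReal_pos.2 ht).ne'
        ENNReal.ofReal_ne_top
    _ = _ := by
      rw [lintegral_prod _ hH'.aemeasurable, ← lintegral_const_mul _ hq.lintegral_prod_right']
      congr 1
      refine lintegral_congr fun z => ?_
      rw [lintegral_withDensity_eq_lintegral_mul _ (by fun_prop) (hHz z),
        ← lintegral_const_mul _ (hqz z)]
      refine lintegral_congr fun x => ?_
      rw [Pi.mul_apply, div_eq_mul_inv]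
      ring

lemma ofReal_sub_le_of_one_le {u v w : ℝ≥0∞} {η b : ℝ} (hη : 0 ≤ η) (hb : 0 ≤ b)
    (h : 1 ≤ u + v + w + ENNReal.ofReal b) (hv : v ≤ ENNReal.ofReal η)
    (hw : w ≤ ENNReal.ofReal η) : ENNReal.ofReal (1 - (2 * η + b)) ≤ u := by
  rw [ENNReal.ofReal_sub _ (by positivity), ENNReal.ofReal_one, tsub_le_iff_right]
  calc 1 ≤ _ := h
    _ ≤ u + ENNReal.ofReal η + ENNReal.ofReal η + ENNReal.ofReal b := by gcongr
    _ = u + ENNReal.ofReal (2 * η + b) := by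
      rw [add_assoc, add_assoc, two_mul, add_assoc, ENNReal.ofReal_add hη (by positivity),
        ENNReal.ofReal_add hη hb]

variable {Ω 𝒳 𝒮 : Type*} [MeasurableSpace Ω] [MeasurableSpace 𝒳] [MeasurableSpace 𝒮]
  {P : Measure Ω} [IsProbabilityMeasure P] {X : Ω → 𝒳} {T : Ω → Bool} {Y : Ω → ℝ}
  {α αlo αhi : ℝ} {τ : (N : ℕ) → Measure (Fin N → 𝒮)} [∀ N, IsProbabilityMeasure (τ N)]
  {qlo qhi : (N : ℕ) → (Fin N → 𝒮) → 𝒳 → ℝ} {ehat : (N : ℕ) → (Fin N → 𝒮) → 𝒳 → ℝ≥0∞}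

lemma measurable_quantileError {𝒵 : Type*} [MeasurableSpace 𝒵] {qlo qhi : 𝒵 → 𝒳 → ℝ}
    (hlo : αlo ∈ Set.Ioo (0 : ℝ) 1) (hhi : αhi ∈ Set.Ioo (0 : ℝ) 1)
    (hqlo : Measurable (Function.uncurry qlo)) (hqhi : Measurable (Function.uncurry qhi)) :
    Measurable (Function.uncurry fun z x => quantileError P X Y αlo αhi (qlo z) (qhi z) x) := by
  have h1 : Measurable (condQuantile P X Y αlo) := measurable_quantile_kernel _ hlo
  have h2 : Measurable (condQuantile P X Y αhi) := measurable_quantile_kernel _ hhi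
  exact (hqlo.sub (h1.comp measurable_snd)).abs.max (hqhi.sub (h2.comp measurable_snd)).abs

/-- The consequences of `QuantileConsistent` used for coverage: outside two events of vanishing
probability, the scores below a small negative number decide coverage. -/
lemma QuantileConsistent.exists_bounds (hX : Measurable X) (hT : Measurable T)
    (h_pos : ∀ᵐ x ∂(P.map X), 0 < propensity P T X x)
    (hα : α ∈ Set.Ioo (0 : ℝ) 1) (hlo : αlo ∈ Set.Ioo (0 : ℝ) 1) (hhi : αhi ∈ Set.Ioo (0 : ℝ) 1)
    (hqlo : ∀ N, Measurable (Function.uncurry (qlo N)))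
    (hqhi : ∀ N, Measurable (Function.uncurry (qhi N)))
    (h_ehat : ∀ N, Measurable (Function.uncurry (ehat N)))
    (h_ehat_le : ∀ N z x, ehat N z x ≤ 1)
    (h_ehat_int : ∀ N, ∀ᵐ z ∂(τ N), ∫⁻ x, (ehat N z x)⁻¹ ∂(treatedLaw P T X) < ∞)
    (h : QuantileConsistent P X T Y α αlo αhi τ qlo qhi ehat) {ε : ℝ} (hε : 0 < ε) :
    ∃ t > 0,
      (∀ᵐ x ∂(P.map X), ∀ N z, quantileError P X Y αlo αhi (qlo N z) (qhi N z) x ≤ t →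
        condDistrib Y X P x {y | -t < score (qlo N z) (qhi N z) (x, y)} ≤
          ENNReal.ofReal (α + ε)) ∧
      Tendsto (fun Nn : ℕ × ℕ =>
        ((τ Nn.1).prod (Measure.pi fun _ : Fin Nn.2 => treatedLaw P T X ⊗ₘ condDistrib Y X P))
          (LowScores α t (qlo Nn.1) (qhi Nn.1) (ehat Nn.1) Nn.2)) atTop (𝓝 0) ∧
      Tendsto (fun N => ((τ N).prod (P.map X))
        {q | t < quantileError P X Y αlo αhi (qlo N q.1) (qhi N q.1) q.2}) atTop (𝓝 0) := by
  obtain ⟨hlev, ⟨r, b₁, b₂, hr, hb₁, hb₂, hd⟩, ⟨δ, hδ, hlim⟩, hH1, hH2⟩ := h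
  have hp := measure_treated_ne_zero hX hT h_pos
  have := isProbabilityMeasure_treatedLaw (P := P) hp hX
  have hH (N : ℕ) := measurable_quantileError (P := P) (X := X) (Y := Y) hlo hhi (hqlo N) (hqhi N)
  -- `2 * t ≤ r` keeps the strips inside the region of bounded density; `4 * b₂ * t ≤ ε` bounds the
  -- excess miss probability.
  set t := min (r / 2) (ε / (4 * b₂)) with ht
  have ht0 : 0 < t := lt_min (by positivity) (by positivity)
  have htr : 2 * t ≤ r := by linarith [min_le_left (r / 2) (ε / (4 * b₂))]
  have htε : 4 * b₂ * t ≤ ε := by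
    have := min_le_right (r / 2) (ε / (4 * b₂))
    rw [← ht, le_div_iff₀ (by positivity)] at this
    linarith
  refine ⟨t, ht0, ?_, ?_, ?_⟩
  · filter_upwards [hd] with x hx N z hz
    refine (measure_lt_score_le hlo hhi hb₂ ht0 htr hx hz).trans (ENNReal.ofReal_le_ofReal ?_)
    linarith
  -- The density condition holds `P_X`-almost everywhere, while the calibration covariates follow
  -- the treated law.
  · have hac : treatedLaw P T X ≪ P.map X := by
      rw [treatedLaw_covariate hX hT]
      exact (withDensity_absolutelyContinuous _ _).smul_left _
    set c := min (b₁ * (t / 2)) (αhi - αlo) with hc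
    have hc0 : 0 < c := lt_min (by positivity) (by linarith [hα.2])
    have hcα : c ≤ 1 - α := (min_le_right _ _).trans hlev.le
    have hk {s : ℝ} (hs : 0 < s) : ENNReal.ofReal s ≠ 0 := (ENNReal.ofReal_pos.2 hs).ne'
    refine tendsto_zero_of_le_add_tail (L := fun N n => ((τ N).prod (Measure.pi fun _ : Fin n =>
      treatedLaw P T X ⊗ₘ condDistrib Y X P)) (LowScores α t (qlo N) (qhi N) (ehat N) n))
      (hk (half_pos ht0)) (hk (half_pos hc0)) (hk (by positivity : 0 < c / 8))
      (by positivity : 0 < c / 4) hδ hH1 hlim fun N n hn B hB => ?_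
    refine measure_lowScores_le hα (hqlo N) (hqhi N) (h_ehat N) (h_ehat_le N) (h_ehat_int N)
      (hH N) ht0 hc0 hcα hB hδ ?_ hn
    filter_upwards [hac.ae_le hd] with x hx z hz
    rw [← hlev]
    exact measure_score_lt_add_le hlo hhi hb₁ ht0 (by linarith) hx hz
  · have h1 := ENNReal.Tendsto.const_mul (a := P {ω | T ω = true}) hH2
      (Or.inr (measure_ne_top _ _))
    have h2 := ENNReal.Tendsto.div_const h1 (b := ENNReal.ofReal t)
      (Or.inr (ENNReal.ofReal_pos.2 ht0).ne')
    rw [mul_zero, ENNReal.zero_div] at h2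
    refine tendsto_of_tendsto_of_tendsto_of_le_of_le tendsto_const_nhds h2 (fun _ => zero_le)
      fun N => ?_
    simp only
    rw [map_eq_withDensity_treatedLaw hX hT h_pos]
    exact measure_lt_prod_withDensity_le measurable_propensity (hH N) ht0

end Assembly

end WeightedCQR

/-! ### The main theorem -/

open WeightedCQR in
theorem theorem1
    {Ω 𝒳 𝒮 : Type*} [MeasurableSpace Ω] [StandardBorelSpace Ω]
    [MeasurableSpace 𝒳] [MeasurableSpace 𝒮]
    -- the population: covariates, treatment and potential outcomes of a generic unit
    (P : Measure Ω) [IsProbabilityMeasure P]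
    (X : Ω → 𝒳) (T : Ω → Bool) (Y1 Y0 : Ω → ℝ)
    (hX : Measurable X) (hT : Measurable T) (hY1 : Measurable Y1) (hY0 : Measurable Y0)
    -- strong ignorability
    (h_ign : CondIndepFun (MeasurableSpace.comap X inferInstance) hX.comap_le
      (fun ω => (Y1 ω, Y0 ω)) T P)
    -- the propensity score is positive almost surely
    (h_pos : ∀ᵐ x ∂(P.map X), 0 < propensity P T X x)
    -- the levels
    (α αlo αhi : ℝ) (hα : α ∈ Set.Ioo (0 : ℝ) 1)
    (hlo : αlo ∈ Set.Ioo (0 : ℝ) 1) (hhi : αhi ∈ Set.Ioo (0 : ℝ) 1)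
    -- the law of the training fold of size `N`
    (τ : (N : ℕ) → Measure (Fin N → 𝒮)) (hτ : ∀ N, IsProbabilityMeasure (τ N))
    -- the fitted quantiles and the fitted propensity score
    (qlo qhi : (N : ℕ) → (Fin N → 𝒮) → 𝒳 → ℝ)
    (ehat : (N : ℕ) → (Fin N → 𝒮) → 𝒳 → ℝ≥0∞)
    (hqlo : ∀ N, Measurable (Function.uncurry (qlo N)))
    (hqhi : ∀ N, Measurable (Function.uncurry (qhi N)))
    (h_ehat : ∀ N, Measurable (Function.uncurry (ehat N)))
    (h_ehat_le : ∀ N z x, ehat N z x ≤ 1)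
    (h_ehat_int : ∀ N, ∀ᵐ z ∂(τ N), ∫⁻ x, (ehat N z x)⁻¹ ∂(treatedLaw P T X) < ∞) :
    (PropensityConsistent P X T τ ehat ∨ QuantileConsistent P X T Y1 α αlo αhi τ qlo qhi ehat →
      ENNReal.ofReal (1 - α) ≤
        liminf (fun Nn : ℕ × ℕ =>
          coverage (τ Nn.1) (treatedLaw P T fun ω => (X ω, observedOutcome T Y1 Y0 ω))
            (P.map fun ω => (X ω, Y1 ω)) α (qlo Nn.1) (qhi Nn.1) (ehat Nn.1) Nn.2) atTop) ∧
    (QuantileConsistent P X T Y1 α αlo αhi τ qlo qhi ehat →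
      ∀ ε : ℝ, 0 < ε →
        Tendsto (fun Nn : ℕ × ℕ =>
          (P.map X) {x |
            (conditionalCoverage (τ Nn.1)
              (treatedLaw P T fun ω => (X ω, observedOutcome T Y1 Y0 ω))
              (condDistrib Y1 X P x) α (qlo Nn.1) (qhi Nn.1) (ehat Nn.1) Nn.2 x).toReal
              ≤ 1 - α - ε}) atTop (𝓝 0)) := by
  have hp := measure_treated_ne_zero hX hT h_pos
  have hμ : IsProbabilityMeasure (treatedLaw P T X) := isProbabilityMeasure_treatedLaw hp hX
  have hπ : IsProbabilityMeasure (P.map X) := Measure.isProbabilityMeasure_map hX.aemeasurable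
  have hH (N : ℕ) := measurable_quantileError (P := P) (X := X) (Y := Y1) hlo hhi (hqlo N) (hqhi N)
  have htest : P.map (fun ω => (X ω, Y1 ω)) = P.map X ⊗ₘ condDistrib Y1 X P :=
    (compProd_map_condDistrib hY1.aemeasurable).symm
  rw [treatedLaw_eq_compProd hX hT hY1 hY0 h_ign hp, htest]
  have e1 : Tendsto (Prod.fst : ℕ × ℕ → ℕ) atTop atTop := by
    rw [← prod_atTop_atTop_eq]
    exact tendsto_fst
  refine ⟨?_, fun hA2 ε hε => ?_⟩
  · rintro (hA1 | hA2)
    · have hD := (ENNReal.Tendsto.const_mul (a := 2 * P {ω | T ω = true}) hA1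
        (Or.inr (ENNReal.mul_ne_top (by simp) (measure_ne_top _ _)))).comp e1
      rw [mul_zero] at hD
      refine le_liminf_of_le_add_tendsto (Eventually.of_forall fun Nn => ?_) hD
      have hinv : Measurable fun x => (propensity P T X x)⁻¹ := measurable_propensity.inv
      have hc : P {ω | T ω = true} * ∫⁻ x, (propensity P T X x)⁻¹ ∂(treatedLaw P T X) = 1 := by
        rw [← lintegral_const_mul _ hinv, ← setLIntegral_univ,
          ← withDensity_apply _ MeasurableSet.univ, ← map_eq_withDensity_treatedLaw hX hT h_pos,
          measure_univ]
      have h := le_coverage_add_absDiff (κ := condDistrib Y1 X P) (n := Nn.2) hα (hqlo Nn.1)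
        (hqhi Nn.1) (h_ehat Nn.1) (h_ehat_int Nn.1) hinv hc
      rwa [← map_eq_withDensity_treatedLaw hX hT h_pos] at h
    · refine ENNReal.le_of_forall_pos_le_add fun ε hε _ => ?_
      have hε' : (0 : ℝ) < ε := hε
      obtain ⟨t, ht, hb, hL, hQ⟩ := hA2.exists_bounds hX hT h_pos hα hlo hhi hqlo hqhi h_ehat
        h_ehat_le h_ehat_int (half_pos hε')
      have hη : 0 < ENNReal.ofReal (ε / 4) := ENNReal.ofReal_pos.2 (by positivity)
      rw [← tsub_le_iff_right]
      refine le_liminf_of_le (by isBoundedDefault) ?_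
      filter_upwards [hL.eventually_le_const hη, (hQ.comp e1).eventually_le_const hη]
        with Nn h1 h2
      have h3 := ofReal_sub_le_of_one_le (η := ε / 4) (b := α + ε / 2) (by positivity)
        (by linarith [hα.1])
        (one_le_coverage_add (hqlo Nn.1) (hqhi Nn.1) (hH Nn.1)
          (hb.mono fun x hx z hz => hx Nn.1 z hz)) h1 h2
      refine le_trans (le_of_eq ?_) h3
      rw [← ENNReal.ofReal_coe_nnreal, ← ENNReal.ofReal_sub _ hε'.le]
      congr 1
      ring
  · obtain ⟨t, ht, hb, hL, hQ⟩ := hA2.exists_bounds hX hT h_pos hα hlo hhi hqlo hqhi h_ehat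
      h_ehat_le h_ehat_int (half_pos hε)
    -- The total loss `2 * (ε / 8) + ε / 2` stays strictly below `ε`, as the event is defined by a
    -- non-strict inequality.
    have hη : 0 < ENNReal.ofReal (ε / 8) := ENNReal.ofReal_pos.2 (by positivity)
    have hQ' := (ENNReal.Tendsto.div_const hQ (b := ENNReal.ofReal (ε / 8))
      (Or.inr hη.ne')).comp e1
    rw [ENNReal.zero_div] at hQ'
    refine tendsto_of_tendsto_of_tendsto_of_le_of_le' tendsto_const_nhds hQ'
      (Eventually.of_forall fun _ => zero_le) ?_
    filter_upwards [hL.eventually_le_const hη] with Nn h1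
    have hQm : MeasurableSet {q : (Fin Nn.1 → 𝒮) × 𝒳 |
        t < quantileError P X Y1 αlo αhi (qlo Nn.1 q.1) (qhi Nn.1 q.1) q.2} :=
      measurableSet_lt measurable_const (hH Nn.1)
    have hmarkov := meas_ge_le_lintegral_div (μ := P.map X)
      (measurable_measure_prodMk_right (μ := τ Nn.1) hQm).aemeasurable hη.ne' ENNReal.ofReal_ne_top
    rw [← Measure.prod_apply_symm hQm] at hmarkov
    -- Once `LowScores` is rare, undercoverage at `x` forces the training folds with error above `t`
    -- at `x` to have probability at least `ε / 8`; Markov's inequality bounds the `P_X`-mass of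
    -- such `x`.
    refine le_trans (measure_mono_ae ?_) hmarkov
    filter_upwards [hb] with x hx hcov
    by_contra hlt
    have h3 := ofReal_sub_le_of_one_le (η := ε / 8) (b := α + ε / 2) (by positivity)
      (by linarith [hα.1])
      (one_le_conditionalCoverage_add (κ := condDistrib Y1 X P) (hqlo Nn.1) (hqhi Nn.1)
        (hH Nn.1) (fun z hz => hx Nn.1 z hz)) h1 (not_le.1 hlt).le
    have h4 := (ENNReal.ofReal_le_iff_le_toReal (measure_ne_top _ _)).1 h3
    have h5 : (conditionalCoverage (τ Nn.1) (treatedLaw P T X ⊗ₘ condDistrib Y1 X P)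
      (condDistrib Y1 X P x) α (qlo Nn.1) (qhi Nn.1) (ehat Nn.1) Nn.2 x).toReal ≤ 1 - α - ε := hcov
    rw [conditionalCoverage] at h5
    linarith
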